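/- Let $[n]=\{1,\dots,n\}$ and let $\|p-q\|_{\mathrm{TV}}=\frac12\sum_x|p(x)-q(x)|$. A product distribution on $[n]\times[m]$ is a distribution of the form $p(i,j)=p_1(i)\,p_2(j)$ with $p_1,p_2$ distributions on $[n]$ and $[m]$; a distribution is $\varepsilon$-far from product if its total variation distance to every product distribution is greater than $\varepsilon$. For $\alpha\in[0,1]$ and $\varepsilon,\delta\in(0,1)$, an $(\alpha,\varepsilon,\delta)$-augmented independence tester for distributions on $[n]\times[m]$ with $k$ samples is a randomized algorithm that receives a full description of a distribution $\hat p$ on $[n]\times[m]$ (the prediction) and $k$ independent samples from an unknown distribution $p$ on $[n]\times[m]$, outputs one of "accept", "reject", "inaccurate information", and satisfies for all $p$ and $\hat p$: (i) if $\|p-\hat p\|_{\mathrm{TV}}\le\alpha$, it outputs "inaccurate information" with probability at most $\delta/2$; (ii) if $p$ is a product distribution, it outputs "reject" with probability at most $\delta/2$; (iii) if $p$ is $\varepsilon$-far from product, it outputs "accept" with probability at most $\delta/2$. Theorem. There is an absolute constant $c>0$ such that for all integers $n\ge m\ge 2$ with $\log n\le m$, all $\alpha\in[0,1]$ and all $\varepsilon\in(0,1/3)$,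 every $(\alpha,\varepsilon,0.1)$-augmented independence tester for distributions on $[n]\times[m]$ uses $$k\ \ge\ c\cdot\max\left\{\frac{\sqrt{nm}}{\varepsilon^{2}},\ \frac{n^{2/3}m^{1/3}\alpha^{1/3}}{\varepsilon^{4/3}}\right\}$$ samples. -/

import Mathlib

namespace AugIndep

/-- Probability distributions on a finite set `Ω`: nonnegative weights of total mass one. -/
abbrev Distr (Ω : Type*) [Fintype Ω] : Type _ := stdSimplex ℝ Ω

/-- Total variation distance between two distributions on a finite set. -/
noncomputable def tvDist {Ω : Type*} [Fintype Ω] (p q : Distr Ω) : ℝ :=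
  (1 / 2) * ∑ x, |p.1 x - q.1 x|

/-- A distribution on `[n] × [m]` that is the product of a distribution on `[n]` and one on `[m]`. -/
def IsProductDist {n m : ℕ} (p : Distr (Fin n × Fin m)) : Prop :=
  ∃ (p₁ : Distr (Fin n)) (p₂ : Distr (Fin m)), ∀ i j, p.1 (i, j) = p₁.1 i * p₂.1 j

/-- `p` is at total variation distance more than `ε` from every product distribution. -/
def IsFarFromProduct {n m : ℕ} (ε : ℝ) (p : Distr (Fin n × Fin m)) : Prop :=
  ∀ q : Distr (Fin n × Fin m), IsProductDist q → ε < tvDist p q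

/-- The three possible outputs of an augmented tester. -/
inductive Verdict
  | accept
  | reject
  | inaccurateInformation
  deriving DecidableEq

instance : Fintype Verdict where
  elems := {Verdict.accept, Verdict.reject, Verdict.inaccurateInformation}
  complete v := by cases v <;> simp

/-- A randomized algorithm that knows a prediction `p̂` completely, uses at most `k` samples, and
outputs a verdict: every prediction and every sequence of `k` samples determine the distribution of
the output over the internal randomness. (An algorithm that stops early, adaptively or at random,
is one that ignores some of the `k` samples.) -/
abbrev Tester (n m k : ℕ) : Type :=
  Distr (Fin n × Fin m) → (Fin k → Fin n × Fin m) → Distr Verdict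

/-- The probability that `T`, given the prediction `phat` and `k` independent samples from `p`,
outputs `v`. -/
noncomputable def outputProb {n m k : ℕ} (T : Tester n m k) (phat p : Distr (Fin n × Fin m))
    (v : Verdict) : ℝ :=
  ∑ x : Fin k → Fin n × Fin m, (∏ i, p.1 (x i)) * (T phat x).1 v

/-- `T` is an `(α, ε, δ)`-augmented independence tester: for every unknown distribution `p` and
every prediction `phat`, each of the three kinds of error has probability at most `δ / 2`. -/
structure IsAugmentedIndependenceTester {n m k : ℕ} (α ε δ : ℝ) (T : Tester n m k) : Prop where
  /-- If the prediction is `α`-close to `p`, the tester rarely declares it inaccurate. -/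
  inaccurate_le : ∀ phat p : Distr (Fin n × Fin m), tvDist p phat ≤ α →
    outputProb T phat p Verdict.inaccurateInformation ≤ δ / 2
  /-- If `p` is a product distribution, the tester rarely rejects. -/
  reject_le : ∀ phat p : Distr (Fin n × Fin m), IsProductDist p →
    outputProb T phat p Verdict.reject ≤ δ / 2
  /-- If `p` is `ε`-far from all product distributions, the tester rarely accepts. -/
  accept_le : ∀ phat p : Distr (Fin n × Fin m), IsFarFromProduct ε p →
    outputProb T phat p Verdict.accept ≤ δ / 2

end AugIndep

/-! Both bounds are χ² arguments. The prediction is the uniform distribution on a grid of cells. A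
product distribution within `α` of it must be accepted with probability at least 0.9
(`le_outputProb_accept`), while a far distribution is accepted with probability at most 0.05. By
`sq_sum_sub_mul_le`, the χ² divergence between any mixture of such product distributions and any
mixture of far ones is therefore bounded below. Far distributions come from tilting each square
block of the grid towards a random shifted diagonal, which a product cannot follow
(`le_tvDist_of_perturbed`, `le_tvDist_of_fully_perturbed`).

For `√(nm)/ε²` the null is the prediction itself and the blocks have side two. With `N` blocks the
second moment is at most `exp((k e²)²/(2N))` (`sum_sum_pow_le`), where the tilt `e` is of order `ε`.

For the second bound each row group is independently heavy with probability `η`. A heavy group has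
flat weight `B` in both hypotheses; a light group has weight 1 and is tilted only under the
alternative. Heavy groups carry mass of order `ηB ≤ α`, so the null stays within `α` of the
prediction. They mask collisions: two or more samples are needed to see the tilt in a group, but the
null likelihood of `t` samples in one group already contains `ηB^t`, by which the second moment of
the tilt gets divided (`mul_pred_mul_pow_div_le`). With `B` of order `n/k` and `η` of order `αk/n`
the resulting exponent is of order `ε⁴k³/(αmn²)` (`sum_prod_count_le`, `sum_mixture_sq_div_le`).
Likelihoods are left unnormalised so that they factor over groups. This tilts the prior by the
`k`-th power of the total mass, and `sum_bad_le` shows that the tilted prior still rarely has too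
many heavy groups.

This construction needs `nα²ε⁴` to exceed a multiple of `m`. Otherwise the second bound is dominated
by the first (`le_of_direct_regime`). -/

namespace AugIndep

open Finset

/-! ### Perturbed blocks and their distance from rank one -/

section Bump

variable {A : Type*} [AddCommGroup A] [Fintype A] [DecidableEq A]

/-- The centred indicator of the shifted diagonal `j = i + r`, scaled to have mean zero in every
row and values `|A| - 1` and `-1`. -/
noncomputable def bump (r i j : A) : ℝ := (if j = i + r then (Fintype.card A : ℝ) else 0) - 1

theorem sum_bump (r i : A) : ∑ j, bump r i j = 0 := by
  simp [bump, Finset.sum_sub_distrib]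

/-- Two shifted diagonals meet in a row only if the shifts agree, so the correlation is again a
bump, now in the shifts. It averages to zero over a uniform shift, which removes the first-order
terms from the second moments. -/
theorem sum_bump_mul_bump (r r' i : A) :
    ∑ j, bump r i j * bump r' i j = Fintype.card A * bump 0 r r' := by
  have h : ∀ j, bump r i j * bump r' i j =
      (if j = i + r then (if r' = r then (Fintype.card A : ℝ) ^ 2 else 0) else 0)
        - (if j = i + r then (Fintype.card A : ℝ) else 0)
        - (if j = i + r' then (Fintype.card A : ℝ) else 0) + 1 := by
    intro j
    unfold bump
    by_cases h1 : j = i + r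
    · subst h1
      by_cases h2 : r' = r
      · subst h2; simp; ring
      · have : ¬ r = r' := fun h => h2 h.symm
        simp [this, h2]; ring
    · by_cases h2 : j = i + r'
      · subst h2; simp [h1]; ring
      · simp [h1, h2]
  simp_rw [h, Finset.sum_add_distrib, Finset.sum_sub_distrib]
  simp only [Finset.sum_ite_eq', Finset.mem_univ, if_true, Finset.sum_const, Finset.card_univ,
    nsmul_eq_mul, mul_one, bump, add_zero]
  split_ifs <;> ring

theorem neg_one_le_bump (r i j : A) : -1 ≤ bump r i j := by
  unfold bump; split_ifs <;> simp

theorem bump_le (r i j : A) : bump r i j ≤ Fintype.card A - 1 := by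
  unfold bump; split_ifs <;> simp

theorem one_add_mul_bump_nonneg {e : ℝ} (he : 0 ≤ e) (he1 : e ≤ 1) (r i j : A) :
    0 ≤ 1 + e * bump r i j := by
  nlinarith [neg_one_le_bump r i j]

/-- A perturbed block is far in `ℓ¹` from every matrix of rank one with nonnegative factors. -/
theorem le_sum_abs_block [Nontrivial A] {c e : ℝ} (r : A) (a b : A → ℝ)
    (ha : ∀ i, 0 ≤ a i) :
    c * e * (Fintype.card A : ℝ) ^ 2 / 2
      ≤ ∑ i, ∑ j, |c * (1 + e * bump r i j) - a i * b j| := by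
  obtain ⟨d, hd⟩ := exists_ne (0 : A)
  set L : ℝ := (Fintype.card A : ℝ) with hL
  set F : A → A → ℝ := fun i j => |c * (1 + e * bump r i j) - a i * b j| with hF
  have hrow : ∀ i j j', j ≠ j' → F i j + F i j' ≤ ∑ j, F i j := by
    intro i j j' hj
    rw [← Finset.sum_pair hj]
    exact Finset.sum_le_sum_of_subset_of_nonneg (Finset.subset_univ _)
      (fun _ _ _ => abs_nonneg _)
  have key : ∀ i, c * e * L ≤ (∑ j, F i j) + ∑ j, F (i + d) j := by
    intro i
    have hne : i + r ≠ i + d + r := by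
      intro h
      apply hd
      have : i + r = (i + r) + d := h.trans (by abel)
      simpa using this.symm
    have h1 := hrow i (i + r) (i + d + r) hne
    have h2 := hrow (i + d) (i + r) (i + d + r) hne
    have e1 : bump r i (i + r) = L - 1 := by simp [bump, L]
    have e2 : bump r (i + d) (i + d + r) = L - 1 := by simp [bump, L]
    have e3 : bump r i (i + d + r) = -1 := by simp [bump, hne.symm]
    have e4 : bump r (i + d) (i + r) = -1 := by simp [bump, hne]
    have hF0 : ∀ i j, 0 ≤ F i j := fun i j => abs_nonneg _
    -- Rows `i` and `i + d` have their peaks in opposite columns of the same pair. The row whose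
    -- peak column has the smaller `b` errs by at least `c * e * L`.
    rcases le_total (b (i + r)) (b (i + d + r)) with hb | hb
    · have hF1 := hF0 (i + d) (i + r)
      have hF2 := hF0 (i + d) (i + d + r)
      have t1 := le_abs_self (c * (1 + e * bump r i (i + r)) - a i * b (i + r))
      have t2 := neg_abs_le (c * (1 + e * bump r i (i + d + r)) - a i * b (i + d + r))
      have t3 := mul_le_mul_of_nonneg_left hb (ha i)
      simp only [hF] at *
      rw [e1] at *; rw [e3] at *
      nlinarith
    · have := hF0 i (i + r)
      have := hF0 i (i + d + r)
      have t1 := le_abs_self (c * (1 + e * bump r (i + d) (i + d + r)) - a (i + d) * b (i + d + r))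
      have t2 := neg_abs_le (c * (1 + e * bump r (i + d) (i + r)) - a (i + d) * b (i + r))
      have t3 := mul_le_mul_of_nonneg_left hb (ha (i + d))
      simp only [hF] at *
      rw [e2] at *; rw [e4] at *
      nlinarith
  have hsum := Finset.sum_le_sum (s := univ) (fun i _ => key i)
  -- Translation by `d` permutes the rows, so every row is counted twice; hence the factor 1/2.
  have hperm : ∑ i, ∑ j, F (i + d) j = ∑ i, ∑ j, F i j :=
    Equiv.sum_comp (Equiv.addRight d) (fun i => ∑ j, F i j)
  rw [Finset.sum_add_distrib, hperm] at hsum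
  simp only [Finset.sum_const, Finset.card_univ, nsmul_eq_mul] at hsum
  change L * _ ≤ _ at hsum
  nlinarith

/-- The fully perturbed block loses all of its mass to a product except what the product puts on
the shifted diagonal. -/
theorem sum_sub_min_block {c : ℝ} (r : A) (a b : A → ℝ)
    (ha : ∀ i, 0 ≤ a i) (hb : ∀ i, 0 ≤ b i) :
    ∑ i, ∑ j, (c * (1 + 1 * bump r i j) - min (c * (1 + 1 * bump r i j)) (a i * b j)) =
      c * (Fintype.card A : ℝ) ^ 2 - ∑ i, min (c * Fintype.card A) (a i * b (i + r)) := by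
  have h : ∀ i j, (c * (1 + 1 * bump r i j) - min (c * (1 + 1 * bump r i j)) (a i * b j)) =
      if j = i + r then c * Fintype.card A - min (c * Fintype.card A) (a i * b j) else 0 := by
    intro i j
    have := mul_nonneg (ha i) (hb j)
    unfold bump
    split_ifs with hj
    · simp
    · simp [this]
  simp_rw [h]
  simp only [Finset.sum_ite_eq', Finset.mem_univ, if_true, Finset.sum_sub_distrib,
    Finset.sum_const, Finset.card_univ, nsmul_eq_mul]
  ring

end Bump

/-- A minimum is at most the geometric mean. Cauchy–Schwarz then gives `√(C Q)`, with `Q` the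
product of the two sums, and AM–GM splits it as `Q/4 + C`. -/
theorem sum_min_mul_le {A : Type*} [AddCommGroup A] [Fintype A] {C : ℝ} (hC : 0 ≤ C) (r : A) (a b : A → ℝ)
    (ha : ∀ i, 0 ≤ a i) (hb : ∀ i, 0 ≤ b i) :
    ∑ i, min C (a i * b (i + r)) ≤ 1 / 4 * ((∑ i, a i) * ∑ i, b i) + 1 * C := by
  have hSa : 0 ≤ ∑ i, a i := Finset.sum_nonneg fun i _ => ha i
  have hSb : 0 ≤ ∑ i, b i := Finset.sum_nonneg fun i _ => hb i
  have h1 : ∀ i, min C (a i * b (i + r)) ≤ √C * (√(a i) * √(b (i + r))) := by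
    intro i
    have hv := mul_nonneg (ha i) (hb (i + r))
    rw [← Real.sqrt_mul (ha i), ← Real.sqrt_mul hC]
    apply Real.le_sqrt_of_sq_le
    rw [sq]
    exact mul_le_mul (min_le_left _ _) (min_le_right _ _) (le_min hC hv) hC
  have h2 := Real.sum_sqrt_mul_sqrt_le univ (fun i => ha i) (fun i => hb (i + r))
  have hperm : ∑ i, b (i + r) = ∑ i, b i := Equiv.sum_comp (Equiv.addRight r) b
  rw [hperm] at h2
  have h3 := Finset.sum_le_sum (s := univ) (fun i _ => h1 i)
  rw [← Finset.mul_sum] at h3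
  have h4 := mul_le_mul_of_nonneg_left h2 (Real.sqrt_nonneg C)
  rw [← Real.sqrt_mul hSa] at h4
  have hQ := mul_nonneg hSa hSb
  nlinarith [Real.sq_sqrt hC, Real.sq_sqrt hQ, sq_nonneg (√C - √((∑ i, a i) * ∑ i, b i) / 2)]

/-- Because `xt · yz = xz · yt`, the smaller minimum is also paid for by the off-diagonal products,
and the larger one is at most `C`. For side two this yields distance 1/3, where `sum_min_mul_le`
would yield only 1/4. -/
theorem min_add_min_le {C x y z t : ℝ} (hC : 0 ≤ C) (hx : 0 ≤ x) (hy : 0 ≤ y) (hz : 0 ≤ z)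
    (ht : 0 ≤ t) :
    min C (x * z) + min C (y * t) ≤ 1 / 3 * ((x + y) * (z + t)) + 2 / 3 * C := by
  have hxz := mul_nonneg hx hz
  have hyt := mul_nonneg hy ht
  have hxt := mul_nonneg hx ht
  have hyz := mul_nonneg hy hz
  set X := min C (x * z)
  set Y := min C (y * t)
  have hX0 : 0 ≤ X := le_min hC hxz
  have hY0 : 0 ≤ Y := le_min hC hyt
  have hXC : X ≤ C := min_le_left _ _
  have hYC : Y ≤ C := min_le_left _ _
  have hX : X ≤ x * z := min_le_right _ _
  have hY : Y ≤ y * t := min_le_right _ _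
  have hm : 2 * min X Y ≤ x * t + y * z := by
    apply le_of_sq_le_sq _ (by positivity)
    have h1 : min X Y * min X Y ≤ (x * z) * (y * t) :=
      mul_le_mul ((min_le_left _ _).trans hX) ((min_le_right _ _).trans hY) (le_min hX0 hY0) hxz
    nlinarith [sq_nonneg (x * t - y * z)]
  rcases le_total X Y with h | h
  · rw [min_eq_left h] at hm; nlinarith
  · rw [min_eq_right h] at hm; nlinarith

theorem sum_min_mul_le_zmod_two {C : ℝ} (hC : 0 ≤ C) (r : ZMod 2) (a b : ZMod 2 → ℝ)
    (ha : ∀ i, 0 ≤ a i) (hb : ∀ i, 0 ≤ b i) :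
    ∑ i, min C (a i * b (i + r)) ≤ 1 / 3 * ((∑ i, a i) * ∑ i, b i) + 2 / 3 * C := by
  have h := min_add_min_le hC (ha 0) (ha 1) (hb (0 + r)) (hb (1 + r))
  have hperm : ∑ i, b (i + r) = ∑ i, b i := Equiv.sum_comp (Equiv.addRight r) b
  rw [← hperm]
  have : (univ : Finset (ZMod 2)) = {0, 1} := by decide
  simpa [this] using h

/-! ### Total variation under maps and on subsets -/

section TotalVariation

variable {Ω X : Type*} [Fintype Ω] [Fintype X]

theorem map_apply [DecidableEq X] (f : Ω → X) (p : Distr Ω) (y : X) :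
    (stdSimplex.map f p).1 y = ∑ x, if f x = y then p.1 x else 0 := by
  change FunOnFinite.linearMap ℝ ℝ f p.1 y = _
  rw [FunOnFinite.linearMap_apply_apply, Finset.sum_filter]

theorem map_apply_of_injective {f : Ω → X} (hf : Function.Injective f) (p : Distr Ω) (x : Ω) :
    (stdSimplex.map f p).1 (f x) = p.1 x := by
  classical
  rw [map_apply]
  simp [hf.eq_iff]

theorem tvDist_map_le (f : Ω → X) (p q : Distr Ω) :
    tvDist (stdSimplex.map f p) (stdSimplex.map f q) ≤ tvDist p q := by
  classical
  unfold tvDist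
  refine mul_le_mul_of_nonneg_left ?_ (by norm_num)
  calc ∑ y, |(stdSimplex.map f p).1 y - (stdSimplex.map f q).1 y|
      ≤ ∑ y, ∑ x, if f x = y then |p.1 x - q.1 x| else 0 := by
        refine Finset.sum_le_sum fun y _ => ?_
        rw [map_apply, map_apply, ← Finset.sum_sub_distrib]
        refine (Finset.abs_sum_le_sum_abs _ _).trans (Finset.sum_le_sum fun x _ => ?_)
        split_ifs <;> simp
    _ = ∑ x, |p.1 x - q.1 x| := by
        rw [Finset.sum_comm]
        simp

theorem half_sum_abs_le_tvDist {Ω : Type*} {f : Ω → X} (hf : Function.Injective f) (s : Finset Ω)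
    (p q : Distr X) : 1 / 2 * ∑ x ∈ s, |p.1 (f x) - q.1 (f x)| ≤ tvDist p q := by
  classical
  unfold tvDist
  refine mul_le_mul_of_nonneg_left ?_ (by norm_num)
  rw [← Finset.sum_image (f := fun y => |p.1 y - q.1 y|) (fun x _ y _ h => hf h)]
  exact Finset.sum_le_sum_of_subset_of_nonneg (Finset.subset_univ _) fun _ _ _ => abs_nonneg _

theorem tvDist_eq_sum_sub_min (p q : Distr X) :
    tvDist p q = ∑ x, (p.1 x - min (p.1 x) (q.1 x)) := by
  have h : ∀ x, |p.1 x - q.1 x| = 2 * (p.1 x - min (p.1 x) (q.1 x)) - p.1 x + q.1 x := by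
    intro x
    rcases le_total (p.1 x) (q.1 x) with h | h
    · rw [min_eq_left h, abs_of_nonpos (by linarith)]; ring
    · rw [min_eq_right h, abs_of_nonneg (by linarith)]; ring
  have hp : ∑ x, p.1 x = 1 := p.2.2
  have hq : ∑ x, q.1 x = 1 := q.2.2
  unfold tvDist
  simp_rw [h]
  rw [Finset.sum_add_distrib, Finset.sum_sub_distrib, ← Finset.mul_sum, hp, hq]
  ring

theorem sum_sub_min_le_tvDist {Ω : Type*} {f : Ω → X} (hf : Function.Injective f) (s : Finset Ω)
    (p q : Distr X) : ∑ x ∈ s, (p.1 (f x) - min (p.1 (f x)) (q.1 (f x))) ≤ tvDist p q := by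
  classical
  rw [tvDist_eq_sum_sub_min,
    ← Finset.sum_image (f := fun y => p.1 y - min (p.1 y) (q.1 y)) (fun x _ y _ h => hf h)]
  exact Finset.sum_le_sum_of_subset_of_nonneg (Finset.subset_univ _)
    fun _ _ _ => sub_nonneg.2 (min_le_left _ _)

theorem sum_comp_le_one {f : Ω → X} (hf : Function.Injective f) (q : Distr X) :
    ∑ x, q.1 (f x) ≤ 1 := by
  classical
  rw [← Finset.sum_image (f := fun y => q.1 y) (fun x _ y _ h => hf h)]
  exact (Finset.sum_le_sum_of_subset_of_nonneg (Finset.subset_univ _)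
    fun _ _ _ => q.2.1 _).trans_eq q.2.2

end TotalVariation

/-! ### The grid of cells and distance from products -/

section Cells

variable {Γ A κ : Type*} {n m : ℕ}

/-- The cell of `[n] × [m]` with a given position in a row group and in a column block. -/
def cellMap (ρ : Γ × A → Fin n) (γ : κ × A → Fin m) (ω : Γ × A × κ × A) : Fin n × Fin m :=
  (ρ (ω.1, ω.2.1), γ ω.2.2)

theorem cellMap_injective {ρ : Γ × A → Fin n} {γ : κ × A → Fin m} (hρ : Function.Injective ρ)
    (hγ : Function.Injective γ) : Function.Injective (cellMap ρ γ) := by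
  rintro ⟨g, i, J⟩ ⟨g', i', J'⟩ h
  simp only [cellMap, Prod.mk.injEq] at h
  have h1 := hρ h.1
  have h2 := hγ h.2
  simp only [Prod.mk.injEq] at h1
  simp [h1.1, h1.2, h2]

variable [Fintype Γ] [Fintype A] [Fintype κ]

theorem isProductDist_map_cellMap {ρ : Γ × A → Fin n} {γ : κ × A → Fin m}
    (u : Distr (Γ × A)) (v : Distr (κ × A)) (p : Distr (Γ × A × κ × A))
    (hp : ∀ ω, p.1 ω = u.1 (ω.1, ω.2.1) * v.1 ω.2.2) :
    IsProductDist (stdSimplex.map (cellMap ρ γ) p) := by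
  classical
  refine ⟨stdSimplex.map ρ u, stdSimplex.map γ v, fun i j => ?_⟩
  simp_rw [map_apply, hp]
  rw [Finset.sum_mul_sum, Fintype.sum_prod_type, Fintype.sum_prod_type]
  refine Finset.sum_congr rfl fun g _ => ?_
  rw [Fintype.sum_prod_type]
  refine Finset.sum_congr rfl fun a _ => Finset.sum_congr rfl fun b _ => ?_
  by_cases h1 : ρ (g, a) = i <;> by_cases h2 : γ b = j <;> simp [cellMap, h1, h2]

variable [AddCommGroup A] [DecidableEq A]

/-- A product restricted to a block has rank one, so `le_sum_abs_block` applies to each block. One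
half comes from there and one from the definition of total variation; the bracket is the total mass
of the blocks over `S`. -/
theorem le_tvDist_of_perturbed {Γ : Type*} [Nontrivial A] {ρ : Γ × A → Fin n} {γ : κ × A → Fin m}
    (hρ : Function.Injective ρ) (hγ : Function.Injective γ) (S : Finset Γ) {c e : ℝ}
    (r : Γ → κ → A) {p q : Distr (Fin n × Fin m)}
    (hp : ∀ g ∈ S, ∀ i J j, p.1 (cellMap ρ γ (g, i, J, j)) = c * (1 + e * bump (r g J) i j))
    (hq : IsProductDist q) :
    e / 4 * (c * (Fintype.card A : ℝ) ^ 2 * (#S * Fintype.card κ)) ≤ tvDist p q := by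
  obtain ⟨q₁, q₂, hq⟩ := hq
  refine le_trans ?_ (half_sum_abs_le_tvDist (cellMap_injective hρ hγ) (S ×ˢ univ) p q)
  rw [Finset.sum_product]
  have h : ∀ g ∈ S, ∑ _J : κ, c * e * (Fintype.card A : ℝ) ^ 2 / 2 ≤
      ∑ b : A × κ × A, |p.1 (cellMap ρ γ (g, b)) - q.1 (cellMap ρ γ (g, b))| := by
    intro g hg
    simp_rw [Fintype.sum_prod_type]
    rw [Finset.sum_comm]
    refine Finset.sum_le_sum fun J _ => ?_
    refine (le_sum_abs_block (r g J) (fun i => q₁.1 (ρ (g, i))) (fun j => q₂.1 (γ (J, j)))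
      (fun i => q₁.2.1 _)).trans_eq ?_
    refine Finset.sum_congr rfl fun i _ => Finset.sum_congr rfl fun j _ => ?_
    rw [hp g hg]
    simp only [cellMap, hq]
  refine le_trans (le_of_eq ?_) (mul_le_mul_of_nonneg_left (Finset.sum_le_sum h) (by norm_num))
  simp only [Finset.sum_const, Finset.card_univ, nsmul_eq_mul]
  ring

/-- At full tilt a block lives on its diagonal, and total variation is at least the mass there that
the product fails to cover. The terms weighted by `s` add up to at most `s`, because the product has
mass one. This serves the larger `ε`, for which a tilt of `5ε` is not available. -/
theorem le_tvDist_of_fully_perturbed {ρ : Γ × A → Fin n} {γ : κ × A → Fin m}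
    (hρ : Function.Injective ρ) (hγ : Function.Injective γ) (S : Finset Γ) {c s t : ℝ}
    (hc : 0 ≤ c) (hs : 0 ≤ s)
    (hblock : ∀ (C : ℝ), 0 ≤ C → ∀ (r : A) (a b : A → ℝ), (∀ i, 0 ≤ a i) → (∀ i, 0 ≤ b i) →
      ∑ i, min C (a i * b (i + r)) ≤ s * ((∑ i, a i) * ∑ i, b i) + t * C)
    (r : Γ → κ → A) {p q : Distr (Fin n × Fin m)}
    (hp : ∀ g ∈ S, ∀ i J j, p.1 (cellMap ρ γ (g, i, J, j)) = c * (1 + 1 * bump (r g J) i j))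
    (hq : IsProductDist q) :
    c * (Fintype.card A : ℝ) ^ 2 * (#S * Fintype.card κ)
      - (s + t * (c * Fintype.card A * (#S * Fintype.card κ))) ≤ tvDist p q := by
  classical
  obtain ⟨q₁, q₂, hq⟩ := hq
  refine le_trans ?_ (sum_sub_min_le_tvDist (cellMap_injective hρ hγ) (S ×ˢ univ) p q)
  rw [Finset.sum_product]
  have h : ∀ g ∈ S, ∑ J : κ, (c * (Fintype.card A : ℝ) ^ 2 -
        (s * ((∑ i, q₁.1 (ρ (g, i))) * ∑ j, q₂.1 (γ (J, j))) + t * (c * Fintype.card A))) ≤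
      ∑ b : A × κ × A, (p.1 (cellMap ρ γ (g, b)) -
        min (p.1 (cellMap ρ γ (g, b))) (q.1 (cellMap ρ γ (g, b)))) := by
    intro g hg
    simp_rw [Fintype.sum_prod_type]
    rw [Finset.sum_comm]
    refine Finset.sum_le_sum fun J _ => ?_
    have h1 := hblock (c * Fintype.card A) (by positivity) (r g J)
      (fun i => q₁.1 (ρ (g, i))) (fun j => q₂.1 (γ (J, j))) (fun i => q₁.2.1 _) (fun i => q₂.2.1 _)
    have h2 := sum_sub_min_block (c := c) (r g J) (fun i => q₁.1 (ρ (g, i)))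
      (fun j => q₂.1 (γ (J, j))) (fun i => q₁.2.1 _) (fun i => q₂.2.1 _)
    have h3 : ∑ i, ∑ j, (p.1 (cellMap ρ γ (g, i, J, j)) -
        min (p.1 (cellMap ρ γ (g, i, J, j))) (q.1 (cellMap ρ γ (g, i, J, j)))) =
        ∑ i, ∑ j, (c * (1 + 1 * bump (r g J) i j) -
          min (c * (1 + 1 * bump (r g J) i j)) (q₁.1 (ρ (g, i)) * q₂.1 (γ (J, j)))) := by
      refine Finset.sum_congr rfl fun i _ => Finset.sum_congr rfl fun j _ => ?_
      rw [hp g hg]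
      simp only [cellMap, hq]
    rw [h3, h2]
    linarith
  refine le_trans ?_ (Finset.sum_le_sum h)
  have e1 : (∑ g ∈ S, ∑ J : κ, (∑ i, q₁.1 (ρ (g, i))) * ∑ j, q₂.1 (γ (J, j))) ≤ 1 := by
    rw [← Finset.sum_mul_sum]
    have h1 : ∑ g ∈ S, ∑ i, q₁.1 (ρ (g, i)) ≤ 1 := by
      refine (Finset.sum_le_sum_of_subset_of_nonneg (Finset.subset_univ _)
        fun _ _ _ => Finset.sum_nonneg fun _ _ => q₁.2.1 _).trans ?_
      rw [← Fintype.sum_prod_type (f := fun x => q₁.1 (ρ x))]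
      exact sum_comp_le_one hρ q₁
    have h2 : ∑ J, ∑ j, q₂.1 (γ (J, j)) ≤ 1 := by
      rw [← Fintype.sum_prod_type (f := fun x => q₂.1 (γ x))]
      exact sum_comp_le_one hγ q₂
    exact mul_le_one₀ h1 (Finset.sum_nonneg fun _ _ => Finset.sum_nonneg fun _ _ => q₂.2.1 _) h2
  simp only [Finset.sum_sub_distrib, Finset.sum_add_distrib, ← Finset.mul_sum, Finset.sum_const,
    Finset.card_univ, nsmul_eq_mul] at e1 ⊢
  nlinarith [mul_le_mul_of_nonneg_left e1 hs]

end Cells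

/-! ### Output probabilities of a tester -/

section Tester

variable {Ω : Type*} [Fintype Ω] {n m k : ℕ}

theorem outputProb_map (T : Tester n m k) (phat : Distr (Fin n × Fin m)) (f : Ω → Fin n × Fin m)
    (p : Distr Ω) (v : Verdict) :
    outputProb T phat (stdSimplex.map f p) v =
      ∑ y : Fin k → Ω, (∏ i, p.1 (y i)) * (T phat (f ∘ y)).1 v := by
  classical
  unfold outputProb
  simp_rw [map_apply, Finset.prod_univ_sum, Fintype.piFinset_univ, Finset.sum_mul]
  rw [Finset.sum_comm]
  refine Finset.sum_congr rfl fun y _ => ?_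
  rw [Finset.sum_eq_single (f ∘ y)]
  · simp
  · intro x _ hx
    obtain ⟨i, hi⟩ : ∃ i, f (y i) ≠ x i := by
      by_contra! h
      exact hx (funext fun i => (h i).symm)
    rw [Finset.prod_eq_zero (Finset.mem_univ i) (by simp [hi]), zero_mul]
  · simp

theorem outputProb_nonneg (T : Tester n m k) (phat p : Distr (Fin n × Fin m)) (v : Verdict) :
    0 ≤ outputProb T phat p v :=
  Finset.sum_nonneg fun x _ =>
    mul_nonneg (Finset.prod_nonneg fun _ _ => p.2.1 _) ((T phat x).2.1 v)

theorem sum_outputProb (T : Tester n m k) (phat p : Distr (Fin n × Fin m)) :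
    outputProb T phat p Verdict.accept + outputProb T phat p Verdict.reject
      + outputProb T phat p Verdict.inaccurateInformation = 1 := by
  have hv : ∀ q : Distr Verdict, q.1 Verdict.accept + q.1 Verdict.reject
      + q.1 Verdict.inaccurateInformation = 1 := by
    intro q
    have h := q.2.2
    have hu : (univ : Finset Verdict) =
      {Verdict.accept, Verdict.reject, Verdict.inaccurateInformation} := rfl
    rw [hu, Finset.sum_insert (by decide), Finset.sum_pair (by decide)] at h
    linarith
  unfold outputProb
  rw [← Finset.sum_add_distrib, ← Finset.sum_add_distrib]
  simp_rw [← mul_add, hv, mul_one]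
  rw [← Fintype.sum_pow, show ∑ x, p.1 x = 1 from p.2.2, one_pow]

theorem outputProb_le_one (T : Tester n m k) (phat p : Distr (Fin n × Fin m)) (v : Verdict) :
    outputProb T phat p v ≤ 1 := by
  have h := sum_outputProb T phat p
  have h1 := outputProb_nonneg T phat p Verdict.accept
  have h2 := outputProb_nonneg T phat p Verdict.reject
  have h3 := outputProb_nonneg T phat p Verdict.inaccurateInformation
  cases v <;> linarith

theorem le_outputProb_accept {α ε : ℝ} {T : Tester n m k}
    (hT : IsAugmentedIndependenceTester α ε 0.1 T) {phat p : Distr (Fin n × Fin m)}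
    (hp : IsProductDist p) (hα : tvDist p phat ≤ α) :
    0.9 ≤ outputProb T phat p Verdict.accept := by
  have h1 := hT.inaccurate_le phat p hα
  have h2 := hT.reject_le phat p hp
  have h3 := sum_outputProb T phat p
  linarith

end Tester

/-! ### The χ² method with unnormalised weights -/

/-- The Cauchy–Schwarz form of the `χ²` bound on distinguishing two nonnegative weights. -/
theorem sq_sum_sub_mul_le {X : Type*} [Fintype X] (f g T : X → ℝ) (hf : ∀ x, 0 < f x)
    (hT0 : ∀ x, 0 ≤ T x) (hT1 : ∀ x, T x ≤ 1) (hfg : ∑ x, g x = ∑ x, f x) :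
    (∑ x, f x * T x - ∑ x, g x * T x) ^ 2 ≤
      (∑ x, g x ^ 2 / f x - ∑ x, f x) * ∑ x, f x := by
  have h1 : ∑ x, f x * T x - ∑ x, g x * T x = ∑ x, ((f x - g x) / √(f x)) * (√(f x) * T x) := by
    rw [← Finset.sum_sub_distrib]
    refine Finset.sum_congr rfl fun x _ => ?_
    have := Real.sqrt_pos.2 (hf x)
    field_simp
  rw [h1]
  refine (Finset.sum_mul_sq_le_sq_mul_sq _ _ _).trans ?_
  have h2 : ∑ x, ((f x - g x) / √(f x)) ^ 2 = ∑ x, g x ^ 2 / f x - ∑ x, f x := by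
    have : ∀ x, ((f x - g x) / √(f x)) ^ 2 = g x ^ 2 / f x - 2 * g x + f x := by
      intro x
      have h0 := hf x
      rw [div_pow, Real.sq_sqrt h0.le]
      field_simp
      ring
    simp_rw [this]
    rw [Finset.sum_add_distrib, Finset.sum_sub_distrib, ← Finset.mul_sum, hfg]
    ring
  rw [← h2]
  refine mul_le_mul_of_nonneg_left (Finset.sum_le_sum fun x _ => ?_)
    (Finset.sum_nonneg fun _ _ => sq_nonneg _)
  rw [mul_pow, Real.sq_sqrt (hf x).le]
  have : T x ^ 2 ≤ 1 := pow_le_one₀ (hT0 x) (hT1 x)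
  nlinarith [hf x]

section Normalize

variable {Ω : Type*} [Fintype Ω]

/-- The distribution proportional to a nonnegative weight of positive total mass. -/
noncomputable def normalize (w : Ω → ℝ) (hw : ∀ x, 0 ≤ w x) (hs : 0 < ∑ x, w x) : Distr Ω :=
  ⟨fun x => w x / ∑ y, w y, fun x => div_nonneg (hw x) hs.le, by
    rw [← Finset.sum_div, div_self hs.ne']⟩

/-- Multiplying by the `k`-th power of the mass clears the normalisation, so likelihoods stay
products of raw weights. -/
theorem pow_mul_outputProb_normalize {n m k : ℕ} (T : Tester n m k)
    (phat : Distr (Fin n × Fin m)) (f : Ω → Fin n × Fin m) (w : Ω → ℝ) (hw : ∀ x, 0 ≤ w x)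
    (hs : 0 < ∑ x, w x) (v : Verdict) :
    (∑ x, w x) ^ k * outputProb T phat (stdSimplex.map f (normalize w hw hs)) v =
      ∑ y : Fin k → Ω, (∏ i, w (y i)) * (T phat (f ∘ y)).1 v := by
  rw [outputProb_map, Finset.mul_sum]
  refine Finset.sum_congr rfl fun y _ => ?_
  simp only [normalize, Finset.prod_div_distrib, Finset.prod_const, Finset.card_univ,
    Fintype.card_fin]
  have := pow_pos hs k
  field_simp

/-- Squaring introduces two replicas `r`, `r'`; for a fixed pair the samples decouple into a power
of the one-sample correlation. -/
theorem sum_prod_mul_sum_prod {k : ℕ} {R : Type*} [Fintype R] (b : R → Ω → ℝ) :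
    ∑ y : Fin k → Ω, (∑ r, ∏ s, b r (y s)) ^ 2 = ∑ r, ∑ r', (∑ x, b r x * b r' x) ^ k := by
  simp_rw [sq, Finset.sum_mul_sum, ← Finset.prod_mul_distrib]
  rw [Finset.sum_comm]
  refine Finset.sum_congr rfl fun r _ => ?_
  rw [Finset.sum_comm]
  exact Finset.sum_congr rfl fun r' _ => (Fintype.sum_pow (fun x => b r x * b r' x) k).symm

end Normalize

theorem sum_prod_eq_prod_sum {ι β : Type*} [Fintype ι] [DecidableEq ι] [Fintype β]
    (F : ι → β → ℝ) : ∑ r : ι → β, ∏ b, F b (r b) = ∏ b, ∑ v, F b v := by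
  rw [Finset.prod_univ_sum, Fintype.piFinset_univ]

/-! ### Correlations of perturbed weights -/

section CellSums

variable {Γ A κ : Type*} [Fintype Γ] [Fintype A] [Fintype κ] [AddCommGroup A] [DecidableEq A]

theorem sum_bump_cells (r : κ → A) : ∑ c : A × κ × A, bump (r c.2.1) c.1 c.2.2 = 0 := by
  simp_rw [Fintype.sum_prod_type, sum_bump, Finset.sum_const_zero]

theorem sum_bump_mul_bump_cells (r r' : κ → A) :
    ∑ c : A × κ × A, bump (r c.2.1) c.1 c.2.2 * bump (r' c.2.1) c.1 c.2.2 =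
      (Fintype.card A : ℝ) ^ 2 * ∑ J, bump 0 (r J) (r' J) := by
  simp_rw [Fintype.sum_prod_type, sum_bump_mul_bump, ← Finset.mul_sum, Finset.sum_const,
    Finset.card_univ, nsmul_eq_mul]
  ring

/-- The correlation of two perturbed weights on the cells of a row group. -/
theorem sum_perturbed_mul_perturbed (e : ℝ) (r r' : κ → A) :
    ∑ c : A × κ × A, (1 + e * bump (r c.2.1) c.1 c.2.2) * (1 + e * bump (r' c.2.1) c.1 c.2.2) =
      (Fintype.card A : ℝ) ^ 2 * (Fintype.card κ + e ^ 2 * ∑ J, bump 0 (r J) (r' J)) := by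
  have h : ∀ c : A × κ × A,
      (1 + e * bump (r c.2.1) c.1 c.2.2) * (1 + e * bump (r' c.2.1) c.1 c.2.2) =
      1 + e * bump (r c.2.1) c.1 c.2.2 + e * bump (r' c.2.1) c.1 c.2.2
        + e ^ 2 * (bump (r c.2.1) c.1 c.2.2 * bump (r' c.2.1) c.1 c.2.2) := fun c => by ring
  simp_rw [h, Finset.sum_add_distrib, ← Finset.mul_sum, sum_bump_cells, sum_bump_mul_bump_cells]
  simp only [Finset.sum_const, Finset.card_univ, Fintype.card_prod, nsmul_eq_mul]
  push_cast
  ring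

theorem sum_perturbed (e : ℝ) (r : κ → A) :
    ∑ c : A × κ × A, (1 + e * bump (r c.2.1) c.1 c.2.2) =
      (Fintype.card A : ℝ) ^ 2 * Fintype.card κ := by
  simp_rw [Finset.sum_add_distrib, ← Finset.mul_sum, sum_bump_cells]
  simp only [Finset.sum_const, Finset.card_univ, Fintype.card_prod, nsmul_eq_mul]
  push_cast
  ring

end CellSums

theorem sum_exp_bump_zmod_two (x : ℝ) (v : ZMod 2) :
    ∑ v', Real.exp (x * bump 0 v v') = 2 * Real.cosh x := by
  have hu : (univ : Finset (ZMod 2)) = {0, 1} := by decide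
  have h1 : (1 : ZMod 2) ≠ 0 := by decide
  rw [hu, Finset.sum_pair h1.symm, Real.cosh_eq]
  have hv : v = 0 ∨ v = 1 := by revert v; decide
  rcases hv with rfl | rfl
  · simp [bump, ZMod.card]; norm_num; ring
  · simp [bump, ZMod.card]; norm_num; ring

/-- The second moment of the likelihood ratio between random perturbations and the uniform
distribution. -/
theorem sum_sum_pow_le {Γ κ : Type*} [Fintype Γ] [Fintype κ] [DecidableEq Γ] [DecidableEq κ]
    [Nonempty Γ] [Nonempty κ]
    {e : ℝ} (he : 0 ≤ e) (he1 : e ≤ 1) (k : ℕ) :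
    ∑ r : Γ × κ → ZMod 2, ∑ r' : Γ × κ → ZMod 2,
        (1 + e ^ 2 / (Fintype.card Γ * Fintype.card κ) * ∑ b, bump 0 (r b) (r' b)) ^ k ≤
      (Fintype.card (Γ × κ → ZMod 2) : ℝ) ^ 2 *
        Real.exp ((k * e ^ 2) ^ 2 / (2 * (Fintype.card Γ * Fintype.card κ))) := by
  set N : ℝ := Fintype.card Γ * Fintype.card κ with hN
  have hNpos : 0 < N := by positivity
  have hcard : (Fintype.card (Γ × κ) : ℝ) = N := by simp [hN]
  have hlow : ∀ r r' : Γ × κ → ZMod 2, -N ≤ ∑ b, bump 0 (r b) (r' b) := by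
    intro r r'
    have := Finset.card_nsmul_le_sum univ (fun b => bump 0 (r b) (r' b)) (-1)
      (fun b _ => neg_one_le_bump _ _ _)
    rw [Finset.card_univ, nsmul_eq_mul, hcard] at this
    linarith
  -- `1 + x ≤ exp x` turns the power into a product over blocks, so the sum over `r'` factors into
  -- hyperbolic cosines.
  have hterm : ∀ r r' : Γ × κ → ZMod 2,
      (1 + e ^ 2 / N * ∑ b, bump 0 (r b) (r' b)) ^ k ≤
        ∏ b, Real.exp (k * e ^ 2 / N * bump 0 (r b) (r' b)) := by
    intro r r'
    have h0 : 0 ≤ 1 + e ^ 2 / N * ∑ b, bump 0 (r b) (r' b) := by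
      have h1 := mul_le_mul_of_nonneg_left (hlow r r') (by positivity : 0 ≤ e ^ 2 / N)
      have h2 : e ^ 2 / N * -N = - e ^ 2 := by field_simp
      nlinarith
    rw [← Real.exp_sum, ← Finset.mul_sum]
    calc _ ≤ (Real.exp (e ^ 2 / N * ∑ b, bump 0 (r b) (r' b))) ^ k := by
          refine pow_le_pow_left₀ h0 ?_ k
          linarith [Real.add_one_le_exp (e ^ 2 / N * ∑ b, bump 0 (r b) (r' b))]
      _ = _ := by rw [← Real.exp_nat_mul]; congr 1; ring
  have hinner : ∀ r : Γ × κ → ZMod 2,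
      ∑ r' : Γ × κ → ZMod 2, ∏ b, Real.exp (k * e ^ 2 / N * bump 0 (r b) (r' b)) ≤
        Fintype.card (Γ × κ → ZMod 2) * Real.exp ((k * e ^ 2) ^ 2 / (2 * N)) := by
    intro r
    rw [sum_prod_eq_prod_sum fun b v => Real.exp (k * e ^ 2 / N * bump 0 (r b) v)]
    simp_rw [sum_exp_bump_zmod_two]
    rw [Finset.prod_const, Finset.card_univ, mul_pow, Fintype.card_fun, ZMod.card]
    push_cast
    refine mul_le_mul_of_nonneg_left ?_ (by positivity)
    refine (pow_le_pow_left₀ (Real.cosh_pos _).le (Real.cosh_le_exp_half_sq _) _).trans_eq ?_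
    rw [← Real.exp_nat_mul, hcard]
    congr 1
    field_simp
  calc _ ≤ ∑ _r : Γ × κ → ZMod 2,
        (Fintype.card (Γ × κ → ZMod 2) * Real.exp ((k * e ^ 2) ^ 2 / (2 * N))) :=
        Finset.sum_le_sum fun r _ => (Finset.sum_le_sum fun r' _ => hterm r r').trans (hinner r)
    _ = _ := by
        rw [Finset.sum_const, Finset.card_univ, nsmul_eq_mul]; ring

/-! ### The bound with a uniform null hypothesis -/

section UniformNull

variable {Γ κ : Type*} [Fintype Γ] [Fintype κ] {n m k : ℕ}

theorem perturbed_weight_sum (e : ℝ) (r : Γ × κ → ZMod 2) :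
    ∑ ω : Γ × ZMod 2 × κ × ZMod 2, (1 + e * bump (r (ω.1, ω.2.2.1)) ω.2.1 ω.2.2.2) =
      4 * (Fintype.card Γ * Fintype.card κ) := by
  rw [Fintype.sum_prod_type]
  have := fun g : Γ => sum_perturbed e (fun J : κ => r (g, J))
  simp_rw [this, Finset.sum_const, Finset.card_univ, ZMod.card, nsmul_eq_mul]
  push_cast
  ring

theorem perturbed_weight_sum_mul [Nonempty Γ] [Nonempty κ] (e : ℝ) (r r' : Γ × κ → ZMod 2) :
    ∑ ω : Γ × ZMod 2 × κ × ZMod 2, (1 + e * bump (r (ω.1, ω.2.2.1)) ω.2.1 ω.2.2.2) *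
        (1 + e * bump (r' (ω.1, ω.2.2.1)) ω.2.1 ω.2.2.2) =
      4 * (Fintype.card Γ * Fintype.card κ) *
        (1 + e ^ 2 / (Fintype.card Γ * Fintype.card κ) * ∑ b, bump 0 (r b) (r' b)) := by
  rw [Fintype.sum_prod_type, Fintype.sum_prod_type]
  have := fun g : Γ => sum_perturbed_mul_perturbed e (fun J : κ => r (g, J)) (fun J => r' (g, J))
  simp_rw [this, ← Finset.mul_sum, Finset.sum_add_distrib, ← Finset.mul_sum, Finset.sum_const,
    Finset.card_univ, ZMod.card, nsmul_eq_mul]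
  have h1 : (Fintype.card Γ : ℝ) ≠ 0 := by positivity
  have h2 : (Fintype.card κ : ℝ) ≠ 0 := by positivity
  field_simp
  push_cast
  ring

/-- The averaged likelihood of the perturbations is compared with the constant weight 1. The
acceptance probabilities differ by at least 0.9 − 0.05 = 0.85, and 1 + 0.85² exceeds 1.7. -/
theorem le_exp_of_uniform_null [DecidableEq Γ] [DecidableEq κ] [Nonempty Γ] [Nonempty κ] {α ε e : ℝ} {T : Tester n m k} (hα : 0 ≤ α)
    (hT : IsAugmentedIndependenceTester α ε 0.1 T) (he : 0 ≤ e) (he1 : e ≤ 1)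
    (f : Γ × ZMod 2 × κ × ZMod 2 → Fin n × Fin m) (u : Distr (Γ × ZMod 2 × κ × ZMod 2))
    (hu : ∀ ω, u.1 ω = 1 / (4 * (Fintype.card Γ * Fintype.card κ)))
    (hnull : IsProductDist (stdSimplex.map f u))
    (hfar : ∀ (r : Γ × κ → ZMod 2) (p : Distr (Γ × ZMod 2 × κ × ZMod 2)),
      (∀ ω, p.1 ω = 1 / (4 * (Fintype.card Γ * Fintype.card κ)) *
        (1 + e * bump (r (ω.1, ω.2.2.1)) ω.2.1 ω.2.2.2)) →
      IsFarFromProduct ε (stdSimplex.map f p)) :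
    1.7 ≤ Real.exp ((k * e ^ 2) ^ 2 / (2 * (Fintype.card Γ * Fintype.card κ))) := by
  set N : ℝ := Fintype.card Γ * Fintype.card κ with hN
  have hNpos : 0 < N := by positivity
  set R : ℝ := (Fintype.card (Γ × κ → ZMod 2) : ℝ) with hR
  have hRpos : 0 < R := by positivity
  set phat := stdSimplex.map f u
  set t : (Fin k → Γ × ZMod 2 × κ × ZMod 2) → ℝ := fun y => (T phat (f ∘ y)).1 Verdict.accept
  set w : (Γ × κ → ZMod 2) → Γ × ZMod 2 × κ × ZMod 2 → ℝ :=
    fun r ω => 1 + e * bump (r (ω.1, ω.2.2.1)) ω.2.1 ω.2.2.2 with hw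
  have hw0 : ∀ r ω, 0 ≤ w r ω := fun r ω => one_add_mul_bump_nonneg he he1 _ _ _
  have hws : ∀ r, ∑ ω, w r ω = 4 * N := fun r => perturbed_weight_sum e r
  have hwpos : ∀ r, 0 < ∑ ω, w r ω := fun r => by rw [hws]; positivity
  have hcard : (Fintype.card (Fin k → Γ × ZMod 2 × κ × ZMod 2) : ℝ) = (4 * N) ^ k := by
    simp only [Fintype.card_fun, Fintype.card_prod, Fintype.card_fin, ZMod.card, hN]
    push_cast
    ring
  have hpow : 0 < (4 * N) ^ k := by positivity
  have hacc0 : 0.9 * (4 * N) ^ k ≤ ∑ y, t y := by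
    have h1 := le_outputProb_accept hT hnull (phat := phat) (by simpa [tvDist, phat] using hα)
    rw [outputProb_map] at h1
    simp_rw [hu, Finset.prod_const, Finset.card_univ, Fintype.card_fin, ← Finset.mul_sum] at h1
    have h2 := mul_le_mul_of_nonneg_left h1 hpow.le
    have h3 : (4 * N) ^ k * (1 / (4 * N)) ^ k = 1 := by
      rw [← mul_pow, mul_one_div_cancel (by positivity), one_pow]
    rw [← mul_assoc ((4 * N) ^ k), h3, one_mul] at h2
    linarith
  have hacc1 : ∀ r, ∑ y : Fin k → _, (∏ s, w r (y s)) * t y ≤ 0.05 * (4 * N) ^ k := by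
    intro r
    have h1 := hT.accept_le phat _ (hfar r (normalize (w r) (hw0 r) (hwpos r)) (fun ω => by
      change w r ω / ∑ ω, w r ω = _
      rw [hws]; ring))
    have h2 := pow_mul_outputProb_normalize T phat f (w r) (hw0 r) (hwpos r) Verdict.accept
    rw [← h2, hws]
    nlinarith
  set g : (Fin k → Γ × ZMod 2 × κ × ZMod 2) → ℝ := fun y => R⁻¹ * ∑ r, ∏ s, w r (y s) with hg
  have hgT : ∑ y, g y * t y ≤ 0.05 * (4 * N) ^ k := by
    simp only [hg, mul_assoc, Finset.sum_mul]
    rw [← Finset.mul_sum, Finset.sum_comm]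
    have h1 := Finset.sum_le_sum (s := univ) (fun r _ => hacc1 r)
    rw [Finset.sum_const, Finset.card_univ, nsmul_eq_mul, ← hR] at h1
    have h2 := mul_le_mul_of_nonneg_left h1 (inv_pos.2 hRpos).le
    rwa [← mul_assoc, inv_mul_cancel₀ hRpos.ne', one_mul] at h2
  have hgsum : ∑ y, g y = (4 * N) ^ k := by
    simp only [hg]
    rw [← Finset.mul_sum, Finset.sum_comm]
    simp_rw [← Fintype.sum_pow, hws, Finset.sum_const, Finset.card_univ, nsmul_eq_mul, ← hR]
    field_simp
  have hg2 : ∑ y, g y ^ 2 ≤ (4 * N) ^ k * Real.exp ((k * e ^ 2) ^ 2 / (2 * N)) := by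
    simp only [hg, mul_pow]
    rw [← Finset.mul_sum, sum_prod_mul_sum_prod]
    simp only [hw]
    simp_rw [perturbed_weight_sum_mul, ← hN, mul_pow _ _ k, ← Finset.mul_sum]
    have h1 := sum_sum_pow_le (Γ := Γ) (κ := κ) he he1 k
    rw [← hN, ← hR] at h1
    have h2 := mul_le_mul_of_nonneg_left h1 (by positivity : 0 ≤ R⁻¹ ^ 2 * (4 * N) ^ k)
    refine le_trans (le_of_eq ?_) (h2.trans_eq ?_)
    · rw [mul_pow 4 N k]; ring
    · rw [mul_comm (R⁻¹ ^ 2), mul_assoc, ← mul_assoc (R⁻¹ ^ 2), ← mul_pow,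
        inv_mul_cancel₀ hRpos.ne', one_pow, one_mul, mul_pow 4 N k, mul_pow (k : ℝ)]
  have hCS := sq_sum_sub_mul_le (fun _ => (1 : ℝ)) g t (fun _ => one_pos)
    (fun y => (T phat (f ∘ y)).2.1 _)
    (fun y => stdSimplex.le_one (T phat (f ∘ y)) Verdict.accept)
    (by simpa [← hcard] using hgsum)
  simp only [one_mul, div_one, Finset.sum_const, Finset.card_univ, nsmul_eq_mul, mul_one,
    hcard] at hCS
  set P := (4 * N) ^ k
  have hdiff : 0.85 * P ≤ ∑ y, t y - ∑ y, g y * t y := by linarith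
  have hsq : (0.85 * P) ^ 2 ≤ (P * Real.exp ((k * e ^ 2) ^ 2 / (2 * N)) - P) * P := by
    refine (pow_le_pow_left₀ (by positivity) hdiff 2).trans (hCS.trans ?_)
    refine mul_le_mul_of_nonneg_right ?_ hpow.le
    linarith
  have : (0.85 : ℝ) ^ 2 * (P * P) ≤ (Real.exp ((k * e ^ 2) ^ 2 / (2 * N)) - 1) * (P * P) := by
    nlinarith
  have := le_of_mul_le_mul_right this (by positivity)
  norm_num at this ⊢
  linarith

end UniformNull

theorem exists_injective_fin_div {n L : ℕ} [NeZero L] :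
    ∃ ρ : Fin (n / L) × ZMod L → Fin n, Function.Injective ρ := by
  have : Nonempty ((Fin (n / L) × ZMod L) ↪ Fin n) := by
    apply Function.Embedding.nonempty_of_card_le
    simpa [ZMod.card] using Nat.div_mul_le_self n L
  exact ⟨this.some, this.some.injective⟩

/-- The uniform distribution on a nonempty finite type. -/
noncomputable def uniform (Ω : Type*) [Fintype Ω] [Nonempty Ω] : Distr Ω :=
  ⟨fun _ => 1 / Fintype.card Ω, fun _ => by positivity, by
    rw [Finset.sum_const, Finset.card_univ, nsmul_eq_mul, mul_one_div_cancel (by positivity)]⟩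

theorem div_three_le_div_two {n : ℕ} (hn : 2 ≤ n) : (n : ℝ) / 3 ≤ (n / 2 : ℕ) := by
  have h : n ≤ 3 * (n / 2) := by omega
  have : (n : ℝ) ≤ 3 * (n / 2 : ℕ) := by exact_mod_cast h
  linarith

theorem sqrt_mul_div_sq_le {n m k : ℕ} {α ε : ℝ} {T : Tester n m k} (hn : 2 ≤ n) (hm : 2 ≤ m)
    (hα : 0 ≤ α) (hε : 0 < ε) (hε3 : ε < 1 / 3)
    (hT : IsAugmentedIndependenceTester α ε 0.1 T) :
    √((n : ℝ) * m) / ε ^ 2 ≤ 75 * k := by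
  obtain ⟨ρ, hρ⟩ := exists_injective_fin_div (n := n) (L := 2)
  obtain ⟨γ, hγ⟩ := exists_injective_fin_div (n := m) (L := 2)
  have hΓ : Nonempty (Fin (n / 2)) := ⟨⟨0, by omega⟩⟩
  have hκ : Nonempty (Fin (m / 2)) := ⟨⟨0, by omega⟩⟩
  have hn0 : (n : ℝ) / 3 ≤ (n / 2 : ℕ) := div_three_le_div_two hn
  have hm0 : (m : ℝ) / 3 ≤ (m / 2 : ℕ) := div_three_le_div_two hm
  have hnR : (2 : ℝ) ≤ n := by exact_mod_cast hn
  have hmR : (2 : ℝ) ≤ m := by exact_mod_cast hm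
  set G : ℝ := ((n / 2 : ℕ) : ℝ) with hG
  set M : ℝ := ((m / 2 : ℕ) : ℝ) with hM
  have hGpos : 0 < G := by linarith
  have hMpos : 0 < M := by linarith
  -- While `ε < 1/5`, the tilt `5ε` gives distance at least `5ε/4`. From 1/5 on the tilt is full,
  -- and the distance is at least 1 − (1/3 + 2/3 · 1/2) = 1/3.
  set e : ℝ := min 1 (5 * ε) with he
  have he0 : 0 ≤ e := le_min zero_le_one (by linarith)
  have he1 : e ≤ 1 := min_le_left _ _
  have he5 : e ≤ 5 * ε := min_le_right _ _
  have key := le_exp_of_uniform_null hα hT he0 he1 (cellMap ρ γ)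
    (uniform (Fin (n / 2) × ZMod 2 × Fin (m / 2) × ZMod 2))
    (fun ω => by
      simp only [uniform, Fintype.card_prod, ZMod.card, Fintype.card_fin]
      push_cast
      ring)
    (isProductDist_map_cellMap (uniform _) (uniform _) _ (fun ω => by
      simp only [uniform, Fintype.card_prod, ZMod.card, Fintype.card_fin]
      push_cast
      field_simp))
    (by
      intro r p hp q hq
      simp only [Fintype.card_fin] at hp
      have hcell : ∀ g ∈ (univ : Finset (Fin (n / 2))), ∀ i J j,
          (stdSimplex.map (cellMap ρ γ) p).1 (cellMap ρ γ (g, i, J, j)) =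
            1 / (4 * (G * M)) * (1 + e * bump (r (g, J)) i j) := by
        intro g _ i J j
        rw [map_apply_of_injective (cellMap_injective hρ hγ), hp]
      rcases lt_or_ge ε (1 / 5) with h5 | h5
      · have h := le_tvDist_of_perturbed hρ hγ univ (fun g J => r (g, J)) hcell hq
        have hmass : 1 / (4 * (G * M)) * ((Fintype.card (ZMod 2) : ℕ) : ℝ) ^ 2 *
            ((#(univ : Finset (Fin (n / 2))) : ℝ) * (Fintype.card (Fin (m / 2)) : ℝ)) = 1 := by
          simp only [ZMod.card, Finset.card_univ, Fintype.card_fin]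
          push_cast
          rw [← hG, ← hM]
          field_simp
          norm_num
        rw [hmass, he, min_eq_right (by linarith)] at h
        linarith
      · have hee : e = 1 := by rw [he, min_eq_left (by linarith)]
        rw [hee] at hcell
        have h := le_tvDist_of_fully_perturbed hρ hγ univ (by positivity)
          (by norm_num : (0 : ℝ) ≤ 1 / 3)
          (fun C hC r a b ha hb => sum_min_mul_le_zmod_two hC r a b ha hb)
          (fun g J => r (g, J)) hcell hq
        have hmass : 1 / (4 * (G * M)) * ((Fintype.card (ZMod 2) : ℕ) : ℝ) ^ 2 *
            ((#(univ : Finset (Fin (n / 2))) : ℝ) * (Fintype.card (Fin (m / 2)) : ℝ)) = 1 := by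
          simp only [ZMod.card, Finset.card_univ, Fintype.card_fin]
          push_cast
          rw [← hG, ← hM]
          field_simp
          norm_num
        have hmass' : 1 / (4 * (G * M)) * ((Fintype.card (ZMod 2) : ℕ) : ℝ) *
            ((#(univ : Finset (Fin (n / 2))) : ℝ) * (Fintype.card (Fin (m / 2)) : ℝ)) = 1 / 2 := by
          simp only [ZMod.card, Finset.card_univ, Fintype.card_fin]
          push_cast
          rw [← hG, ← hM]
          field_simp
          norm_num
        rw [hmass, hmass'] at h
        linarith)
  simp only [Fintype.card_fin] at key
  rw [← hG, ← hM] at key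
  -- Hence `(k e²)² > G M ≥ nm/9`; with `e² ≤ 25ε²` this is the constant 75 = 3 · 25.
  have hhalf : Real.exp (1 / 2) < 1.7 := by
    have h1 : Real.exp (1 / 2) ^ 2 = Real.exp 1 := by rw [← Real.exp_nat_mul]; norm_num
    have h2 := Real.exp_one_lt_d9
    apply lt_of_pow_lt_pow_left₀ 2 (by norm_num)
    rw [h1]
    norm_num at h2 ⊢
    linarith
  have hx := Real.exp_lt_exp.1 (hhalf.trans_le key)
  rw [div_lt_div_iff₀ (by norm_num) (by positivity)] at hx
  have hNM : (n : ℝ) * m / 9 ≤ G * M := by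
    have := mul_le_mul hn0 hm0 (by positivity) hGpos.le
    linarith
  have hk : (0 : ℝ) ≤ k := Nat.cast_nonneg k
  rw [div_le_iff₀ (by positivity)]
  apply Real.sqrt_le_iff.2
  refine ⟨by positivity, ?_⟩
  have he2 : e ^ 2 ≤ 25 * ε ^ 2 := by
    calc e ^ 2 ≤ (5 * ε) ^ 2 := pow_le_pow_left₀ he0 he5 2
      _ = _ := by ring
  have h3 : (k * e ^ 2) ^ 2 ≤ (k * (25 * ε ^ 2)) ^ 2 :=
    pow_le_pow_left₀ (by positivity) (mul_le_mul_of_nonneg_left he2 hk) 2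
  nlinarith

/-! ### Independence of coordinates under uniform functions -/

section Coordinates

variable {ι β : Type*} [Fintype ι] [DecidableEq ι] [Fintype β]

/-- For uniform `y` the coordinate `y s` is independent of `H`, which ignores it; this is the
product rule for expectations with denominators cleared. -/
theorem card_mul_sum_mul (s : ι) (f : β → ℝ) (H : (ι → β) → ℝ)
    (hH : ∀ y a, H (Function.update y s a) = H y) :
    Fintype.card β * ∑ y : ι → β, f (y s) * H y = (∑ a, f a) * ∑ y, H y := by
  have hsplit : ∀ F : (ι → β) → ℝ,
      ∑ y, F y = ∑ a, ∑ z, F ((Equiv.funSplitAt s β).symm (a, z)) := by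
    intro F
    rw [← Equiv.sum_comp (Equiv.funSplitAt s β).symm F, Fintype.sum_prod_type]
  have hval : ∀ a z, (Equiv.funSplitAt s β).symm (a, z) s = a := by
    intro a z; simp [Equiv.funSplitAt, Equiv.piSplitAt]
  have hindep : ∀ a a' z, H ((Equiv.funSplitAt s β).symm (a, z)) =
      H ((Equiv.funSplitAt s β).symm (a', z)) := by
    intro a a' z
    rw [← hH ((Equiv.funSplitAt s β).symm (a, z)) a']
    congr 1
    ext j
    by_cases hj : j = s
    · subst hj; simp [hval]
    · simp [Equiv.funSplitAt, Equiv.piSplitAt, hj]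
  rw [hsplit, hsplit, Finset.sum_mul_sum, ← nsmul_eq_mul, ← Finset.card_univ,
    ← Finset.sum_const, Finset.sum_comm]
  refine Finset.sum_congr rfl fun a _ => ?_
  refine Finset.sum_congr rfl fun a' _ => ?_
  rw [Finset.mul_sum]
  refine Finset.sum_congr rfl fun z _ => ?_
  rw [hval, hindep a a']

/-- The variance of a sum of independent centred variables: the cross terms vanish. -/
theorem card_mul_sum_sq_sum (u : ι → β → ℝ) (hu : ∀ J, ∑ v, u J v = 0) :
    Fintype.card β * ∑ r : ι → β, (∑ J, u J (r J)) ^ 2 =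
      (∑ J, ∑ v, u J v ^ 2) * Fintype.card (ι → β) := by
  have h : ∀ J J', Fintype.card β * ∑ r : ι → β, u J (r J) * u J' (r J') =
      if J' = J then (∑ v, u J v ^ 2) * Fintype.card (ι → β) else 0 := by
    intro J J'
    split_ifs with hJ
    · subst hJ
      have := card_mul_sum_mul J' (fun v => u J' v ^ 2) (fun _ => 1) (fun _ _ => rfl)
      simp only [mul_one, Finset.sum_const, Finset.card_univ, nsmul_eq_mul] at this
      simpa only [sq] using this
    · have := card_mul_sum_mul J (u J) (fun r => u J' (r J')) (fun y a => by
        rw [Function.update_of_ne hJ])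
      rw [this, hu, zero_mul]
  simp_rw [sq (∑ J, u J _), Finset.sum_mul_sum]
  rw [Finset.sum_comm, Finset.mul_sum, Finset.sum_mul]
  refine Finset.sum_congr rfl fun J _ => ?_
  rw [Finset.sum_comm, Finset.mul_sum]
  simp_rw [h]
  simp

theorem sum_sum_apply_eq_zero (u : ι → β → ℝ) (hu : ∀ J, ∑ v, u J v = 0) :
    ∑ r : ι → β, ∑ J, u J (r J) = 0 := by
  rw [Finset.sum_comm]
  refine Finset.sum_eq_zero fun J _ => ?_
  have h := card_mul_sum_mul J (u J) (fun _ => 1) (fun _ _ => rfl)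
  simp only [mul_one, hu, zero_mul] at h
  rcases mul_eq_zero.1 h with h | h
  · have : IsEmpty β := Fintype.card_eq_zero_iff.1 (by exact_mod_cast h)
    exact Finset.sum_eq_zero fun r _ => this.elim (r J)
  · exact h

end Coordinates

/-! ### Sample counts per row group -/

section Counts

variable {Γ : Type*} [Fintype Γ] [DecidableEq Γ] {k : ℕ}

/-- The number of samples that fall into group `g`. -/
def count (y : Fin k → Γ) (g : Γ) : ℕ := #{s | y s = g}

theorem sum_count (y : Fin k → Γ) : ∑ g, count y g = k := by
  have := Finset.card_eq_sum_card_fiberwise (f := y) (s := univ) (t := univ) (by simp)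
  simpa [count] using this.symm

theorem prod_pow_count (y : Fin k → Γ) (C : ℝ) : ∏ g, C ^ count y g = C ^ k := by
  rw [Finset.prod_pow_eq_pow_sum, sum_count]

/-- Given the groups of the samples, the states of distinct groups govern disjoint sets of samples.
-/
theorem sum_prod_states {S : Type*} [Fintype S] (π : S → ℝ) (y : Fin k → Γ)
    (b : S → Fin k → ℝ) :
    ∑ σ : Γ → S, (∏ g, π (σ g)) * ∏ s, b (σ (y s)) s =
      ∏ g, ∑ τ, π τ * ∏ s with y s = g, b τ s := by
  rw [← sum_prod_eq_prod_sum fun g τ => π τ * ∏ s with y s = g, b τ s]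
  refine Finset.sum_congr rfl fun σ _ => ?_
  rw [Finset.prod_mul_distrib, ← Finset.prod_fiberwise univ y (fun s => b (σ (y s)) s)]
  congr 1
  refine Finset.prod_congr rfl fun g _ => Finset.prod_congr rfl fun s hs => ?_
  rw [(Finset.mem_filter.1 hs).2]

/-- The second moment over the cells of a mixture of product weights factors over the groups. -/
theorem sum_sq_prod_states {S Cell : Type*} [Fintype S] [Fintype Cell] (π : S → ℝ)
    (a : S → Cell → ℝ) (y : Fin k → Γ) :
    ∑ c : Fin k → Cell, (∏ g, ∑ τ, π τ * ∏ s with y s = g, a τ (c s)) ^ 2 =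
      ∏ g, ∑ τ : S × S, π τ.1 * π τ.2 * (∑ x, a τ.1 x * a τ.2 x) ^ count y g := by
  have h1 : ∀ c : Fin k → Cell, (∏ g, ∑ τ, π τ * ∏ s with y s = g, a τ (c s)) ^ 2 =
      ∏ g, ∑ τ : S × S, π τ.1 * π τ.2 * ∏ s with y s = g, a τ.1 (c s) * a τ.2 (c s) := by
    intro c
    rw [← Finset.prod_pow]
    refine Finset.prod_congr rfl fun g _ => ?_
    rw [sq, Finset.sum_mul_sum, Fintype.sum_prod_type]
    refine Finset.sum_congr rfl fun τ _ => Finset.sum_congr rfl fun τ' _ => ?_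
    rw [Finset.prod_mul_distrib]
    ring
  have h2 := fun c : Fin k → Cell => sum_prod_states (fun τ : S × S => π τ.1 * π τ.2) y
    (fun τ s => a τ.1 (c s) * a τ.2 (c s))
  have h3 := sum_prod_states (fun τ : S × S => π τ.1 * π τ.2) y
    (fun τ _ => ∑ x, a τ.1 x * a τ.2 x)
  simp only [Finset.prod_const] at h3
  simp_rw [h1]
  change _ = ∏ g, ∑ τ : S × S, π τ.1 * π τ.2 * (∑ x, a τ.1 x * a τ.2 x) ^ #{s | y s = g}
  rw [← h3]
  simp_rw [← h2]
  rw [Finset.sum_comm]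
  refine Finset.sum_congr rfl fun σ _ => ?_
  rw [← Finset.mul_sum]
  congr 1
  exact sum_prod_eq_prod_sum fun s x => a (σ (y s)).1 x * a (σ (y s)).2 x

theorem count_update_le {Γ : Type*} [DecidableEq Γ] (y : Fin k → Γ) (s : Fin k) {g g₀ : Γ} (hg : g ≠ g₀) :
    count (Function.update y s g₀) g ≤ count y g := by
  unfold count
  refine Finset.card_le_card fun x hx => ?_
  simp only [Finset.mem_filter, Finset.mem_univ, true_and] at hx ⊢
  by_cases hxs : x = s
  · subst hxs; simp at hx; exact absurd hx.symm hg
  · rwa [Function.update_of_ne hxs] at hx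

/-- Forcing sample `s` into `g₀` makes the value independent of `y s` without changing it where `y s
= g₀` already holds. After `card_mul_sum_mul`, the hypothesis on `V` compares the forced value with
the original. -/
theorem card_mul_sum_ite_le (s : Fin k) (g₀ : Γ) (V : (Fin k → Γ) → ℝ)
    (hV : ∀ y, V (Function.update y s g₀) ≤ V y) :
    Fintype.card Γ * ∑ y, (if y s = g₀ then V y else 0) ≤ ∑ y, V y := by
  have h := card_mul_sum_mul s (fun g => if g = g₀ then (1 : ℝ) else 0)
    (fun y => V (Function.update y s g₀)) (fun y a => by simp)
  have h1 : ∀ y : Fin k → Γ, (if y s = g₀ then (1 : ℝ) else 0) * V (Function.update y s g₀) =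
      if y s = g₀ then V y else 0 := by
    intro y
    split_ifs with hy
    · rw [← hy, Function.update_eq_self, one_mul]
    · simp
  simp_rw [h1] at h
  rw [h]
  simpa using Finset.sum_le_sum fun y _ => hV y

/-- The weight counts ordered pairs of distinct samples in `g₀`. There are at most `k²` pairs, and
each gains the inverse square of the number of groups from two uses of `card_mul_sum_ite_le`. -/
theorem sum_count_mul_pred_le [Nonempty Γ] (g₀ : Γ) (V : (Fin k → Γ) → ℝ) (hV0 : ∀ y, 0 ≤ V y)
    (hV : ∀ y s, V (Function.update y s g₀) ≤ V y) :
    ∑ y, (count y g₀ : ℝ) * (count y g₀ - 1) * V y ≤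
      (k : ℝ) ^ 2 / (Fintype.card Γ : ℝ) ^ 2 * ∑ y, V y := by
  have hG : (0 : ℝ) < Fintype.card Γ := by positivity
  have hpair : ∀ y : Fin k → Γ, (count y g₀ : ℝ) * (count y g₀ - 1) * V y =
      ∑ x ∈ (univ : Finset (Fin k)).offDiag,
        if y x.1 = g₀ then (if y x.2 = g₀ then V y else 0) else 0 := by
    intro y
    have h1 : ∑ x ∈ (univ : Finset (Fin k)).offDiag,
        (if y x.1 = g₀ then (if y x.2 = g₀ then V y else 0) else 0) =
        ∑ x ∈ (univ.filter fun s => y s = g₀).offDiag, V y := by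
      simp_rw [← ite_and]
      rw [← Finset.sum_filter]
      refine Finset.sum_congr ?_ fun _ _ => rfl
      ext x
      simp only [Finset.mem_filter, Finset.mem_offDiag, Finset.mem_univ, true_and]
      tauto
    rw [h1, Finset.sum_const, Finset.offDiag_card, nsmul_eq_mul, Nat.cast_sub (Nat.le_mul_self _)]
    unfold count
    push_cast
    ring
  simp_rw [hpair]
  rw [Finset.sum_comm]
  have hx : ∀ x ∈ (univ : Finset (Fin k)).offDiag,
      ∑ y : Fin k → Γ, (if y x.1 = g₀ then (if y x.2 = g₀ then V y else 0) else 0) ≤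
        (∑ y, V y) / (Fintype.card Γ : ℝ) ^ 2 := by
    intro x hx
    have hne : x.1 ≠ x.2 := (Finset.mem_offDiag.1 hx).2.2
    have h1 := card_mul_sum_ite_le x.2 g₀ V (fun y => hV y x.2)
    have h2 := card_mul_sum_ite_le x.1 g₀ (fun y => if y x.2 = g₀ then V y else 0) (fun y => by
      rw [Function.update_of_ne hne.symm]
      split_ifs
      · exact hV y x.1
      · exact le_rfl)
    rw [le_div_iff₀ (by positivity)]
    nlinarith
  refine (Finset.sum_le_card_nsmul _ _ _ hx).trans ?_
  rw [nsmul_eq_mul, Finset.offDiag_card, Finset.card_univ, Fintype.card_fin]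
  have hV' : 0 ≤ ∑ y, V y := Finset.sum_nonneg fun y _ => hV0 y
  have hk : ((k * k - k : ℕ) : ℝ) ≤ (k : ℝ) ^ 2 := by
    rw [sq]; exact_mod_cast Nat.sub_le _ _
  calc _ ≤ (k : ℝ) ^ 2 * ((∑ y, V y) / (Fintype.card Γ : ℝ) ^ 2) :=
        mul_le_mul_of_nonneg_right hk (by positivity)
    _ = _ := by ring

theorem mul_pred_mono : Monotone fun t : ℕ => (t : ℝ) * (t - 1) := by
  refine monotone_nat_of_le_succ fun t => ?_
  push_cast
  nlinarith [(Nat.cast_nonneg t : (0 : ℝ) ≤ t)]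

theorem mul_pred_nonneg (t : ℕ) : 0 ≤ (t : ℝ) * (t - 1) := by
  simpa using mul_pred_mono (Nat.zero_le t)

/-- Adding a small multiple of `t (t - 1)` to every factor changes a sum of products over the
group counts by little. -/
theorem sum_prod_count_le [Nonempty Γ] (φ : ℕ → ℝ) (hφ : ∀ t, 1 / 2 ≤ φ t) (hmono : Monotone φ)
    {x : ℝ} (hx : 0 ≤ x) :
    ∑ y : Fin k → Γ, ∏ g, (φ (count y g) + x * ((count y g : ℝ) * (count y g - 1))) ≤
      Real.exp (2 * x * k ^ 2 / Fintype.card Γ) * ∑ y : Fin k → Γ, ∏ g, φ (count y g) := by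
  set G : ℝ := (Fintype.card Γ : ℝ) with hG
  have hGpos : 0 < G := by positivity
  -- The correction is switched on one group at a time; each group costs a factor `1 + 2 x k² / G²`.
  let F : Finset Γ → Γ → ℕ → ℝ := fun S g t => φ t + if g ∈ S then x * ((t : ℝ) * (t - 1)) else 0
  have hFmono : ∀ S g, Monotone (F S g) := by
    intro S g t t' h
    simp only [F]
    split_ifs
    · exact add_le_add (hmono h) (mul_le_mul_of_nonneg_left (mul_pred_mono h) hx)
    · simpa using hmono h
  have hF2 : ∀ S g t, 1 / 2 ≤ F S g t := by
    intro S g t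
    have := mul_nonneg hx (mul_pred_nonneg t)
    have := hφ t
    simp only [F]
    split_ifs <;> linarith
  have hind : ∀ S : Finset Γ, ∑ y : Fin k → Γ, ∏ g, F S g (count y g) ≤
      (1 + 2 * x * k ^ 2 / G ^ 2) ^ #S * ∑ y : Fin k → Γ, ∏ g, φ (count y g) := by
    intro S
    induction S using Finset.induction_on with
    | empty => simp [F]
    | insert g₀ S hg₀ ih =>
      set V : (Fin k → Γ) → ℝ := fun y => ∏ g ∈ univ.erase g₀, F S g (count y g) with hV
      have hV0 : ∀ y, 0 ≤ V y := fun y =>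
        Finset.prod_nonneg fun g _ => by linarith [hF2 S g (count y g)]
      -- Moving a sample into `g₀` can only lower the other counts, and the factors are monotone.
      have hVup : ∀ y s, V (Function.update y s g₀) ≤ V y := by
        intro y s
        refine Finset.prod_le_prod
          (fun g _ => by linarith [hF2 S g (count (Function.update y s g₀) g)])
          fun g hg => hFmono S g (count_update_le y s (Finset.ne_of_mem_erase hg))
      have hstep : ∀ y : Fin k → Γ, ∏ g, F (insert g₀ S) g (count y g) =
          ∏ g, F S g (count y g) + x * ((count y g₀ : ℝ) * (count y g₀ - 1) * V y) := by
        intro y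
        rw [← Finset.mul_prod_erase univ _ (Finset.mem_univ g₀),
          ← Finset.mul_prod_erase univ (fun g => F S g (count y g)) (Finset.mem_univ g₀)]
        have h1 : ∏ g ∈ univ.erase g₀, F (insert g₀ S) g (count y g) = V y := by
          refine Finset.prod_congr rfl fun g hg => ?_
          simp [F, Finset.mem_insert, Finset.ne_of_mem_erase hg]
        rw [h1]
        simp only [F, Finset.mem_insert_self, if_true, hg₀, if_false, hV]
        ring
      -- The lower bound 1/2 on every factor restores the omitted group at the cost of a factor 2.
      have hVle : ∑ y, V y ≤ 2 * ∑ y : Fin k → Γ, ∏ g, F S g (count y g) := by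
        rw [Finset.mul_sum]
        refine Finset.sum_le_sum fun y _ => ?_
        rw [← Finset.mul_prod_erase univ (fun g => F S g (count y g)) (Finset.mem_univ g₀)]
        have := mul_le_mul_of_nonneg_right (hF2 S g₀ (count y g₀)) (hV0 y)
        simp only [hV] at this ⊢
        linarith
      have hpred := sum_count_mul_pred_le g₀ V hV0 hVup
      simp_rw [hstep]
      rw [Finset.sum_add_distrib, ← Finset.mul_sum, Finset.card_insert_of_notMem hg₀, pow_succ']
      set Z := ∑ y : Fin k → Γ, ∏ g, F S g (count y g)
      have h1 : x * ∑ y, ((count y g₀ : ℝ) * (count y g₀ - 1) * V y) ≤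
          2 * x * k ^ 2 / G ^ 2 * Z := by
        calc _ ≤ x * ((k : ℝ) ^ 2 / G ^ 2 * (2 * Z)) :=
              mul_le_mul_of_nonneg_left (hpred.trans
                (mul_le_mul_of_nonneg_left hVle (by positivity))) hx
          _ = _ := by ring
      calc _ ≤ (1 + 2 * x * k ^ 2 / G ^ 2) * Z := by linarith
        _ ≤ _ := by
          refine (mul_le_mul_of_nonneg_left ih ?_).trans_eq (mul_assoc _ _ _).symm
          positivity
  have huniv := hind univ
  simp only [F, Finset.mem_univ, if_true] at huniv
  refine huniv.trans (mul_le_mul_of_nonneg_right ?_ (Finset.sum_nonneg fun y _ =>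
    Finset.prod_nonneg fun g _ => by linarith [hφ (count y g)]))
  rw [Finset.card_univ]
  calc _ ≤ (Real.exp (2 * x * k ^ 2 / G ^ 2)) ^ Fintype.card Γ := by
        refine pow_le_pow_left₀ (by positivity) ?_ _
        linarith [Real.add_one_le_exp (2 * x * k ^ 2 / G ^ 2)]
    _ = _ := by
        rw [← Real.exp_nat_mul, ← hG]
        congr 1
        field_simp

end Counts

/-- The remainder vanishes for `t ≤ 1`, reflecting that a single sample in a group reveals nothing.
The crude factor `L ^ t` is later absorbed by `B ^ t`. -/
theorem one_add_pow_le {x L : ℝ} (hx : 0 ≤ 1 + x) (hxL : 1 + x ≤ L) (hL : 1 ≤ L) (t : ℕ) :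
    (1 + x) ^ t ≤ 1 + t * x + t * (t - 1) * L ^ t * x ^ 2 := by
  induction t with
  | zero => simp
  | succ t ih =>
    have h1 := mul_le_mul_of_nonneg_right ih hx
    rw [pow_succ]
    refine h1.trans ?_
    have ht := mul_pred_nonneg t
    have ht0 : (0 : ℝ) ≤ t := Nat.cast_nonneg t
    have hLt : 1 ≤ L ^ (t + 1) := one_le_pow₀ hL
    have h2 : (t : ℝ) * (t - 1) * L ^ t * x ^ 2 * (1 + x) ≤
        t * (t - 1) * L ^ (t + 1) * x ^ 2 := by
      have : 0 ≤ (t : ℝ) * (t - 1) * L ^ t * x ^ 2 := by positivity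
      exact (mul_le_mul_of_nonneg_left hxL this).trans_eq (by ring)
    have h3 : (t : ℝ) * x ^ 2 ≤ 2 * t * L ^ (t + 1) * x ^ 2 := by
      have : 0 ≤ (t : ℝ) * x ^ 2 := by positivity
      nlinarith
    push_cast
    nlinarith

theorem sum_arrow_prod {Γ Cell : Type*} [Fintype Γ] [Fintype Cell] {k : ℕ}
    (F : (Fin k → Γ × Cell) → ℝ) :
    ∑ z, F z = ∑ y : Fin k → Γ, ∑ c : Fin k → Cell, F fun s => (y s, c s) := by
  rw [← Equiv.sum_comp (Equiv.arrowProdEquivProdArrow (Fin k) (fun _ => Γ) (fun _ => Cell)).symm F,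
    Fintype.sum_prod_type]
  rfl

/-! ### Random states of a row group -/

section States

variable {A κ : Type*} [Fintype A] [Fintype κ] [DecidableEq κ]

/-- The prior on the state of a row group: heavy with probability `η`, and an independent uniform
shift for every column block. -/
noncomputable def prior (η : ℝ) (τ : Bool × (κ → A)) : ℝ :=
  (if τ.1 then η else 1 - η) / Fintype.card (κ → A)

/-- The factor by which the masses of the row groups in the null hypothesis are mixed. -/
noncomputable def mixFactor (η B : ℝ) (t : ℕ) : ℝ := 1 - η + η * B ^ t

theorem prior_nonneg {η : ℝ} (h0 : 0 ≤ η) (h1 : η ≤ 1) (τ : Bool × (κ → A)) : 0 ≤ prior η τ := by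
  unfold prior
  refine div_nonneg ?_ (Nat.cast_nonneg _)
  split_ifs <;> linarith

theorem sum_prior_mul [Nonempty A] (η : ℝ) (F : Bool → ℝ) :
    ∑ τ : Bool × (κ → A), prior η τ * F τ.1 = η * F true + (1 - η) * F false := by
  have hR : (Fintype.card (κ → A) : ℝ) ≠ 0 := by positivity
  rw [Fintype.sum_prod_type, Fintype.sum_bool]
  simp only [prior, if_true, Bool.false_eq_true, if_false, Finset.sum_const, Finset.card_univ,
    nsmul_eq_mul]
  field_simp

variable [AddCommGroup A] [DecidableEq A]

/-- The unnormalised mass of a cell of a row group in a given state; `e` is the strength of the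
perturbation of light groups. -/
noncomputable def cellWeight (B e : ℝ) (τ : Bool × (κ → A)) (c : A × κ × A) : ℝ :=
  if τ.1 then B else 1 + e * bump (τ.2 c.2.1) c.1 c.2.2

theorem cellWeight_nonneg {κ : Type*} {B e : ℝ} (hB : 0 ≤ B) (he : 0 ≤ e) (he1 : e ≤ 1)
    (τ : Bool × (κ → A)) (c : A × κ × A) : 0 ≤ cellWeight B e τ c := by
  unfold cellWeight
  split_ifs
  · exact hB
  · exact one_add_mul_bump_nonneg he he1 _ _ _

theorem cellWeight_zero {κ : Type*} (B : ℝ) (τ : Bool × (κ → A)) (c : A × κ × A) :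
    cellWeight B 0 τ c = if τ.1 then B else 1 := by
  simp [cellWeight]

theorem sum_cellWeight {κ : Type*} [Fintype κ] (B e : ℝ) (τ : Bool × (κ → A)) :
    ∑ c, cellWeight B e τ c =
      (Fintype.card A : ℝ) ^ 2 * Fintype.card κ * if τ.1 then B else 1 := by
  obtain ⟨b, r⟩ := τ
  cases b
  · simpa [cellWeight] using sum_perturbed e r
  · simp only [cellWeight, if_true, Finset.sum_const, Finset.card_univ, Fintype.card_prod,
      nsmul_eq_mul]
    push_cast
    ring

theorem sum_prior_mul_prod_cellWeight_zero {k : ℕ} {Γ : Type*} [DecidableEq Γ]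
    (η B : ℝ) (y : Fin k → Γ) (c : Fin k → A × κ × A) (g : Γ) :
    ∑ τ, prior η τ * ∏ s with y s = g, cellWeight B 0 τ (c s) = mixFactor η B (count y g) := by
  simp_rw [cellWeight_zero, Finset.prod_const]
  have := sum_prior_mul (A := A) (κ := κ) η (fun b => (if b then B else 1) ^ count y g)
  simp only [count] at this
  rw [this]
  simp [mixFactor, count]
  ring

/-- The moments of the correlation of two independent random perturbations. -/
theorem sum_sum_one_add_pow_le [Nonempty κ] {e : ℝ} (he : 0 ≤ e) (he1 : e ≤ 1) (t : ℕ) :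
    ∑ r : κ → A, ∑ r' : κ → A,
        (1 + e ^ 2 / Fintype.card κ * ∑ J, bump 0 (r J) (r' J)) ^ t ≤
      (Fintype.card (κ → A) : ℝ) ^ 2 * (1 + t * (t - 1) * (Fintype.card A : ℝ) ^ t *
        (e ^ 4 * Fintype.card A / Fintype.card κ)) := by
  set L : ℝ := (Fintype.card A : ℝ) with hL
  set M : ℝ := (Fintype.card κ : ℝ) with hM
  set R : ℝ := (Fintype.card (κ → A) : ℝ) with hR
  have hA : Nonempty A := ⟨0⟩
  have hL1 : 1 ≤ L := by
    rw [hL]; exact_mod_cast Fintype.card_pos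
  have hMpos : 0 < M := by positivity
  have hRpos : 0 < R := by positivity
  have he2 : e ^ 2 ≤ 1 := pow_le_one₀ he he1
  have hinner : ∀ r : κ → A, ∑ r' : κ → A, (1 + e ^ 2 / M * ∑ J, bump 0 (r J) (r' J)) ^ t ≤
      R * (1 + t * (t - 1) * L ^ t * (e ^ 4 * L / M)) := by
    intro r
    -- Averaged over `r'`, the linear term of the expansion disappears and the quadratic term is a
    -- variance.
    have hzero := sum_sum_apply_eq_zero (fun J v => bump 0 (r J) v) (fun J => sum_bump 0 (r J))
    have hsq := card_mul_sum_sq_sum (fun J v => bump 0 (r J) v) (fun J => sum_bump 0 (r J))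
    simp only [sq (bump _ _ _), sum_bump_mul_bump, Finset.sum_const, Finset.card_univ,
      nsmul_eq_mul, ← hL, ← hM, ← hR] at hsq
    have hb : bump (0 : A) 0 0 = L - 1 := by simp [bump, hL]
    rw [hb] at hsq
    have hsq' : ∑ r' : κ → A, (∑ J, bump 0 (r J) (r' J)) ^ 2 ≤ M * L * R := by
      have h1 : L * ∑ r' : κ → A, (∑ J, bump 0 (r J) (r' J)) ^ 2 ≤ L * (M * L * R) := by
        rw [hsq]
        have : 0 ≤ M * L * R := by positivity
        nlinarith
      exact le_of_mul_le_mul_left h1 (by linarith)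
    have hterm : ∀ r' : κ → A, (1 + e ^ 2 / M * ∑ J, bump 0 (r J) (r' J)) ^ t ≤
        1 + t * (e ^ 2 / M) * (∑ J, bump 0 (r J) (r' J)) +
          t * (t - 1) * L ^ t * (e ^ 4 / M ^ 2) * (∑ J, bump 0 (r J) (r' J)) ^ 2 := by
      intro r'
      set b := ∑ J, bump 0 (r J) (r' J)
      have hlow : -M ≤ b := by
        have := Finset.card_nsmul_le_sum univ (fun J => bump 0 (r J) (r' J)) (-1)
          (fun J _ => neg_one_le_bump _ _ _)
        rw [Finset.card_univ, nsmul_eq_mul] at this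
        linarith
      have hup : b ≤ M * (L - 1) := by
        have := Finset.sum_le_card_nsmul univ (fun J => bump 0 (r J) (r' J)) (L - 1)
          (fun J _ => bump_le _ _ _)
        rwa [Finset.card_univ, nsmul_eq_mul] at this
      have hlow' : -1 ≤ b / M := by rw [le_div_iff₀ hMpos]; linarith
      have hup' : b / M ≤ L - 1 := by rw [div_le_iff₀ hMpos]; linarith
      have hx : e ^ 2 / M * b = e ^ 2 * (b / M) := by ring
      have h0 : 0 ≤ 1 + e ^ 2 / M * b := by rw [hx]; nlinarith [sq_nonneg e]
      have h1 : 1 + e ^ 2 / M * b ≤ L := by rw [hx]; nlinarith [sq_nonneg e]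
      refine (one_add_pow_le h0 h1 hL1 t).trans_eq ?_
      ring
    refine (Finset.sum_le_sum fun r' _ => hterm r').trans ?_
    rw [Finset.sum_add_distrib, Finset.sum_add_distrib, ← Finset.mul_sum, ← Finset.mul_sum, hzero,
      Finset.sum_const, Finset.card_univ, nsmul_eq_mul, ← hR]
    have hpred := mul_pred_nonneg t
    have h2 := mul_le_mul_of_nonneg_left hsq'
      (by positivity : 0 ≤ (t : ℝ) * (t - 1) * L ^ t * (e ^ 4 / M ^ 2))
    have h3 : (t : ℝ) * (t - 1) * L ^ t * (e ^ 4 / M ^ 2) * (M * L * R) =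
        R * (t * (t - 1) * L ^ t * (e ^ 4 * L / M)) := by field_simp
    linarith
  refine (Finset.sum_le_sum fun r _ => hinner r).trans_eq ?_
  rw [Finset.sum_const, Finset.card_univ, nsmul_eq_mul, ← hR]
  ring

/-- The correlation of two independent random states. -/
theorem sum_prior_mul_prior_le [Nonempty κ] {η B e : ℝ} (he : 0 ≤ e)
    (he1 : e ≤ 1) (t : ℕ) :
    ∑ τ : (Bool × (κ → A)) × (Bool × (κ → A)), prior η τ.1 * prior η τ.2 *
        (∑ c, cellWeight B e τ.1 c * cellWeight B e τ.2 c) ^ t ≤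
      ((Fintype.card A : ℝ) ^ 2 * Fintype.card κ) ^ t * (mixFactor η B t ^ 2 +
        (1 - η) ^ 2 * (t * (t - 1) * (Fintype.card A : ℝ) ^ t *
          (e ^ 4 * Fintype.card A / Fintype.card κ))) := by
  set C : ℝ := (Fintype.card A : ℝ) ^ 2 * Fintype.card κ with hC
  have hA : Nonempty A := ⟨0⟩
  have hMpos : 0 < (Fintype.card κ : ℝ) := by positivity
  set R : ℝ := (Fintype.card (κ → A) : ℝ) with hR
  have hRpos : 0 < R := by positivity
  have hcardcell : ∀ x : ℝ, ∑ _c : A × κ × A, x = C * x := by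
    intro x
    rw [Finset.sum_const, Finset.card_univ, nsmul_eq_mul, hC]
    simp only [Fintype.card_prod]
    push_cast
    ring
  have hTT : ∀ r r' : κ → A,
      ∑ c, cellWeight B e (true, r) c * cellWeight B e (true, r') c = C * (B * B) := by
    intro r r'
    simp only [cellWeight, if_true, hcardcell]
  have hTF : ∀ r r' : κ → A,
      ∑ c, cellWeight B e (true, r) c * cellWeight B e (false, r') c = C * B := by
    intro r r'
    simp only [cellWeight, if_true, Bool.false_eq_true, if_false, ← Finset.mul_sum, sum_perturbed]
    ring
  have hFT : ∀ r r' : κ → A,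
      ∑ c, cellWeight B e (false, r) c * cellWeight B e (true, r') c = C * B := by
    intro r r'
    simp_rw [← hTF r' r, mul_comm]
  have hFF : ∀ r r' : κ → A,
      ∑ c, cellWeight B e (false, r) c * cellWeight B e (false, r') c =
        C * (1 + e ^ 2 / Fintype.card κ * ∑ J, bump 0 (r J) (r' J)) := by
    intro r r'
    simp only [cellWeight, Bool.false_eq_true, if_false, sum_perturbed_mul_perturbed]
    rw [hC]
    field_simp
  obtain ⟨K, hK⟩ : ∃ K : Bool × (κ → A) → Bool × (κ → A) → ℝ,
      ∀ τ τ', ∑ c, cellWeight B e τ c * cellWeight B e τ' c = K τ τ' := ⟨_, fun _ _ => rfl⟩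
  simp only [hK] at hTT hTF hFT hFF ⊢
  simp only [Fintype.sum_prod_type, Fintype.sum_bool, hTT, hTF, hFT, hFF, prior, if_true,
    Bool.false_eq_true, if_false, mul_pow C, ← Finset.mul_sum, Finset.sum_add_distrib,
    Finset.sum_const, Finset.card_univ, nsmul_eq_mul, ← hR]
  have h := sum_sum_one_add_pow_le (A := A) (κ := κ) he he1 t
  rw [← hR] at h
  have h2 := mul_le_mul_of_nonneg_left h
    (mul_nonneg (by positivity : 0 ≤ C ^ t) (sq_nonneg ((1 - η) / R)))
  have h3 : R * (η / R) = η := by field_simp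
  have h4 : R * ((1 - η) / R) = 1 - η := by field_simp
  have h5 : C ^ t * ((1 - η) / R) ^ 2 * (R ^ 2 * (1 + t * (t - 1) * (Fintype.card A : ℝ) ^ t *
        (e ^ 4 * Fintype.card A / Fintype.card κ))) = C ^ t * (1 - η) ^ 2 *
        (1 + t * (t - 1) * (Fintype.card A : ℝ) ^ t *
        (e ^ 4 * Fintype.card A / Fintype.card κ)) := by field_simp
  rw [h5] at h2
  have e1 : η / R * (η / R) * (C ^ t * (R * (R * (B * B) ^ t))) =
      C ^ t * ((R * (η / R)) ^ 2 * (B ^ t) ^ 2) := by rw [mul_pow B B]; ring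
  have e2 : (1 - η) / R * (η / R) * (C ^ t * (R * (R * B ^ t))) =
      C ^ t * ((R * (η / R)) * (R * ((1 - η) / R)) * B ^ t) := by ring
  have e3 : η / R * ((1 - η) / R) * (C ^ t * (R * (R * B ^ t))) =
      C ^ t * ((R * (η / R)) * (R * ((1 - η) / R)) * B ^ t) := by ring
  rw [e1, e2, e3, h3, h4]
  unfold mixFactor
  linarith

end States

/-! ### Masking by heavy row groups -/

section HeavyNull

variable {Γ A κ : Type*} [Fintype Γ] [DecidableEq Γ] [Fintype A] [Fintype κ] [DecidableEq κ]
  {k : ℕ}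

theorem mixFactor_ge_half {η B : ℝ} (hη0 : 0 ≤ η) (hη : η ≤ 1 / 2) (hB : 0 ≤ B) (t : ℕ) :
    1 / 2 ≤ mixFactor η B t := by
  have : 0 ≤ η * B ^ t := by positivity
  unfold mixFactor
  linarith

theorem mixFactor_mono {η B : ℝ} (hη0 : 0 ≤ η) (hB : 1 ≤ B) : Monotone (mixFactor η B) :=
  fun _ _ h => add_le_add le_rfl (mul_le_mul_of_nonneg_left (pow_le_pow_right₀ hB h) hη0)

/-- The masking step: the denominator is at least the heavy contribution `η * B ^ t`. For `t ≥ 2`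
the ratio `(L / B) ^ t` is largest at `t = 2`; for smaller `t` the numerator vanishes. -/
theorem mul_pred_mul_pow_div_le {η B L D : ℝ} (hη0 : 0 < η) (hη : η ≤ 1 / 2) (hL : 0 ≤ L)
    (hLB : L ≤ B) (hB : 0 < B) (hD : 0 ≤ D) (t : ℕ) :
    (1 - η) ^ 2 * (t * (t - 1) * L ^ t * D) / mixFactor η B t ≤
      (L / B) ^ 2 * D / η * (t * (t - 1)) := by
  have hpred := mul_pred_nonneg t
  have hφ : η * B ^ t ≤ mixFactor η B t := by unfold mixFactor; linarith
  have hη1 : (1 - η) ^ 2 ≤ 1 := pow_le_one₀ (by linarith) (by linarith)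
  have hpos : 0 < η * B ^ t := by positivity
  have hN : 0 ≤ (t : ℝ) * (t - 1) * L ^ t * D := by positivity
  calc _ ≤ (t * (t - 1) * L ^ t * D) / (η * B ^ t) := by
        refine div_le_div₀ hN ?_ hpos hφ
        nlinarith
    _ = (L / B) ^ t * D / η * (t * (t - 1)) := by
        rw [div_pow]; field_simp
    _ ≤ _ := by
        rcases lt_or_ge t 2 with ht | ht
        · have : (t : ℝ) * (t - 1) = 0 := by interval_cases t <;> simp
          rw [this, mul_zero, mul_zero]
        · have hLB1 : L / B ≤ 1 := (div_le_one hB).2 hLB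
          have := pow_le_pow_of_le_one (by positivity) hLB1 ht
          gcongr

variable [AddCommGroup A] [DecidableEq A]

/-- The unnormalised mixture likelihood of a sample. -/
noncomputable def mixture (η B e : ℝ) (z : Fin k → Γ × A × κ × A) : ℝ :=
  ∑ σ : Γ → Bool × (κ → A), (∏ g, prior η (σ g)) * ∏ s, cellWeight B e (σ (z s).1) (z s).2

theorem mixture_eq (η B e : ℝ) (z : Fin k → Γ × A × κ × A) :
    mixture η B e z =
      ∏ g, ∑ τ, prior η τ * ∏ s with (z s).1 = g, cellWeight B e τ (z s).2 :=
  sum_prod_states (prior η) (fun s => (z s).1) (fun τ s => cellWeight B e τ (z s).2)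

/-- Without tilt the likelihood depends only on the group counts, so the χ² quotient can be formed
group by group. -/
theorem mixture_zero (η B : ℝ) (z : Fin k → Γ × A × κ × A) :
    mixture η B 0 z = ∏ g, mixFactor η B (count (fun s => (z s).1) g) := by
  rw [mixture_eq]
  exact Finset.prod_congr rfl fun g _ =>
    sum_prior_mul_prod_cellWeight_zero η B (fun s => (z s).1) (fun s => (z s).2) g

theorem sum_mixture_zero (η B : ℝ) :
    ∑ z : Fin k → Γ × A × κ × A, mixture η B 0 z =
      ((Fintype.card A : ℝ) ^ 2 * Fintype.card κ) ^ k *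
        ∑ y : Fin k → Γ, ∏ g, mixFactor η B (count y g) := by
  simp_rw [mixture_zero]
  rw [sum_arrow_prod, Finset.mul_sum]
  refine Finset.sum_congr rfl fun y _ => ?_
  simp only [Finset.sum_const, Finset.card_univ, nsmul_eq_mul, Fintype.card_fun,
    Fintype.card_prod, Fintype.card_fin]
  push_cast
  ring

/-- The second moment of the likelihood ratio between the two mixtures. -/
theorem sum_mixture_sq_div_le [Nonempty Γ] [Nonempty κ] {η B e : ℝ} (hη0 : 0 < η)
    (hη : η ≤ 1 / 2) (hB : (Fintype.card A : ℝ) ≤ B) (he : 0 ≤ e) (he1 : e ≤ 1) :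
    ∑ z : Fin k → Γ × A × κ × A, mixture η B e z ^ 2 / mixture η B 0 z ≤
      Real.exp (2 * ((Fintype.card A / B) ^ 2 * (e ^ 4 * Fintype.card A / Fintype.card κ) / η)
        * k ^ 2 / Fintype.card Γ) * ∑ z : Fin k → Γ × A × κ × A, mixture η B 0 z := by
  have hA : Nonempty A := ⟨0⟩
  have hL1 : (1 : ℝ) ≤ Fintype.card A := by exact_mod_cast Fintype.card_pos
  have hB1 : 1 ≤ B := hL1.trans hB
  set D : ℝ := e ^ 4 * Fintype.card A / Fintype.card κ with hD
  have hD0 : 0 ≤ D := by positivity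
  set x : ℝ := (Fintype.card A / B) ^ 2 * D / η with hx
  have hx0 : 0 ≤ x := by positivity
  set C : ℝ := (Fintype.card A : ℝ) ^ 2 * Fintype.card κ with hC
  have hφ : ∀ t, 1 / 2 ≤ mixFactor η B t := mixFactor_ge_half hη0.le hη (by linarith)
  rw [sum_mixture_zero, sum_arrow_prod, ← hC]
  have hy : ∀ y : Fin k → Γ, ∑ c : Fin k → A × κ × A,
      mixture η B e (fun s => (y s, c s)) ^ 2 / mixture η B 0 (fun s => (y s, c s)) ≤
      C ^ k * ∏ g, (mixFactor η B (count y g) + x * ((count y g : ℝ) * (count y g - 1))) := by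
    intro y
    simp_rw [mixture_zero, ← Finset.sum_div, mixture_eq]
    rw [sum_sq_prod_states, ← Finset.prod_div_distrib, ← prod_pow_count y C,
      ← Finset.prod_mul_distrib]
    refine Finset.prod_le_prod (fun g _ => ?_) fun g _ => ?_
    · refine div_nonneg (Finset.sum_nonneg fun τ _ => ?_) (by linarith [hφ (count y g)])
      refine mul_nonneg (mul_nonneg (prior_nonneg hη0.le (by linarith) _)
        (prior_nonneg hη0.le (by linarith) _)) (pow_nonneg (Finset.sum_nonneg fun c _ => ?_) _)
      exact mul_nonneg (cellWeight_nonneg (by linarith) he he1 _ _)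
        (cellWeight_nonneg (by linarith) he he1 _ _)
    · set t := count y g
      have hφt : 0 < mixFactor η B t := by linarith [hφ t]
      have h1 := sum_prior_mul_prior_le (A := A) (κ := κ) (η := η) (B := B) he he1 t
      rw [← hC, ← hD] at h1
      have h2 := mul_pred_mul_pow_div_le hη0 hη (by positivity : (0 : ℝ) ≤ Fintype.card A) hB
        (by linarith) hD0 t
      calc _ ≤ _ := div_le_div_of_nonneg_right h1 hφt.le
        _ = C ^ t * (mixFactor η B t + (1 - η) ^ 2 * (t * (t - 1) * (Fintype.card A : ℝ) ^ t * D)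
              / mixFactor η B t) := by field_simp
        _ ≤ _ := by
          refine mul_le_mul_of_nonneg_left ?_ (by positivity)
          linarith
  refine (Finset.sum_le_sum fun y _ => hy y).trans ?_
  rw [← Finset.mul_sum]
  have := mul_le_mul_of_nonneg_left (sum_prod_count_le (Γ := Γ) (k := k) (mixFactor η B) hφ
    (mixFactor_mono hη0.le hB1) hx0) (by positivity : 0 ≤ C ^ k)
  refine this.trans_eq ?_
  ring

/-- The total unnormalised mass of the row groups, in units of a light group. -/
noncomputable def groupMass (B : ℝ) (σ : Γ → Bool × (κ → A)) : ℝ :=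
  ∑ g, if (σ g).1 then B else 1

theorem sum_cellWeight_eq_groupMass {Γ κ : Type*} [Fintype Γ] [Fintype κ] (B e : ℝ) (σ : Γ → Bool × (κ → A)) :
    ∑ ω : Γ × A × κ × A, cellWeight B e (σ ω.1) ω.2 =
      (Fintype.card A : ℝ) ^ 2 * Fintype.card κ * groupMass B σ := by
  rw [Fintype.sum_prod_type]
  simp_rw [sum_cellWeight, ← Finset.mul_sum]
  rfl

theorem sum_cellWeight_pos {Γ κ : Type*} [Fintype Γ] [Fintype κ] [Nonempty Γ] [Nonempty κ] {B : ℝ} (hB : 0 < B) (e : ℝ)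
    (σ : Γ → Bool × (κ → A)) : 0 < ∑ ω : Γ × A × κ × A, cellWeight B e (σ ω.1) ω.2 := by
  rw [sum_cellWeight_eq_groupMass]
  have hA : Nonempty A := ⟨0⟩
  have : 0 < groupMass B σ := Finset.sum_pos
    (fun g _ => by split_ifs; exacts [hB, one_pos]) Finset.univ_nonempty
  positivity

/-- The distribution on cells determined by the states of the row groups. -/
noncomputable def stateDist [Nonempty Γ] [Nonempty κ] {B e : ℝ} (hB : 0 < B) (he : 0 ≤ e)
    (he1 : e ≤ 1) (σ : Γ → Bool × (κ → A)) : Distr (Γ × A × κ × A) :=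
  normalize (fun ω => cellWeight B e (σ ω.1) ω.2)
    (fun _ => cellWeight_nonneg hB.le he he1 _ _) (sum_cellWeight_pos hB e σ)

/-- Each state enters with its prior tilted by `groupMass B σ ^ k`. The tilt does not involve `e`,
so null and alternative put the same weights on states and share their bad states. -/
theorem sum_mixture_mul [Nonempty Γ] [Nonempty κ] {n m : ℕ} {η B e : ℝ} (hB : 0 < B) (he : 0 ≤ e)
    (he1 : e ≤ 1) (T : Tester n m k) (phat : Distr (Fin n × Fin m))
    (f : Γ × A × κ × A → Fin n × Fin m) :
    ∑ z : Fin k → Γ × A × κ × A, mixture η B e z * (T phat (f ∘ z)).1 Verdict.accept =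
      ((Fintype.card A : ℝ) ^ 2 * Fintype.card κ) ^ k *
        ∑ σ : Γ → Bool × (κ → A), (∏ g, prior η (σ g)) * groupMass B σ ^ k *
          outputProb T phat (stdSimplex.map f (stateDist hB he he1 σ)) Verdict.accept := by
  have h : ∀ σ : Γ → Bool × (κ → A), ((Fintype.card A : ℝ) ^ 2 * Fintype.card κ) ^ k *
      ((∏ g, prior η (σ g)) * groupMass B σ ^ k *
          outputProb T phat (stdSimplex.map f (stateDist hB he he1 σ)) Verdict.accept) =
      (∏ g, prior η (σ g)) * ∑ z : Fin k → Γ × A × κ × A,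
        (∏ s, cellWeight B e (σ (z s).1) (z s).2) * (T phat (f ∘ z)).1 Verdict.accept := by
    intro σ
    rw [← pow_mul_outputProb_normalize T phat f (fun ω => cellWeight B e (σ ω.1) ω.2)
      (fun _ => cellWeight_nonneg hB.le he he1 _ _) (sum_cellWeight_pos hB e σ),
      sum_cellWeight_eq_groupMass, mul_pow _ (groupMass B σ)]
    unfold stateDist
    ring
  rw [Finset.mul_sum]
  simp_rw [h, mixture, Finset.sum_mul, Finset.mul_sum]
  rw [Finset.sum_comm]
  exact Finset.sum_congr rfl fun σ _ => Finset.sum_congr rfl fun z _ => by ring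

theorem sum_mixture {η B e : ℝ} :
    ∑ z : Fin k → Γ × A × κ × A, mixture η B e z =
      ((Fintype.card A : ℝ) ^ 2 * Fintype.card κ) ^ k *
        ∑ σ : Γ → Bool × (κ → A), (∏ g, prior η (σ g)) * groupMass B σ ^ k := by
  unfold mixture
  rw [Finset.sum_comm, Finset.mul_sum]
  refine Finset.sum_congr rfl fun σ _ => ?_
  rw [← Finset.mul_sum, ← Fintype.sum_pow (fun ω : Γ × A × κ × A => cellWeight B e (σ ω.1) ω.2),
    sum_cellWeight_eq_groupMass, mul_pow _ (groupMass B σ)]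
  ring

/-- A tester that separates most null states from most perturbed states forces the likelihood
ratio of the two mixtures to have a large second moment. -/
theorem le_exp_of_heavy_null [Nonempty Γ] [Nonempty κ] {n m : ℕ} {η B e : ℝ} (hη0 : 0 < η)
    (hη : η ≤ 1 / 2) (hB0 : 0 < B) (hB : (Fintype.card A : ℝ) ≤ B) (he : 0 ≤ e) (he1 : e ≤ 1)
    (T : Tester n m k) (phat : Distr (Fin n × Fin m)) (f : Γ × A × κ × A → Fin n × Fin m)
    (bad : Finset (Γ → Bool × (κ → A)))
    (hnull : ∀ σ, σ ∉ bad → 0.9 ≤ outputProb T phat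
      (stdSimplex.map f (stateDist hB0 le_rfl zero_le_one σ)) Verdict.accept)
    (halt : ∀ σ, σ ∉ bad → outputProb T phat
      (stdSimplex.map f (stateDist hB0 he he1 σ)) Verdict.accept ≤ 0.05)
    (hbad : ∑ σ ∈ bad, (∏ g, prior η (σ g)) * groupMass B σ ^ k ≤
      0.1 * ∑ σ : Γ → Bool × (κ → A), (∏ g, prior η (σ g)) * groupMass B σ ^ k) :
    1.4 ≤ Real.exp (2 * ((Fintype.card A / B) ^ 2 *
      (e ^ 4 * Fintype.card A / Fintype.card κ) / η) * k ^ 2 / Fintype.card Γ) := by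
  classical
  have hA : Nonempty A := ⟨0⟩
  set X := Real.exp (2 * ((Fintype.card A / B) ^ 2 *
      (e ^ 4 * Fintype.card A / Fintype.card κ) / η) * k ^ 2 / Fintype.card Γ)
  set C : ℝ := ((Fintype.card A : ℝ) ^ 2 * Fintype.card κ) ^ k with hC
  have hCpos : 0 < C := by positivity
  set u : (Γ → Bool × (κ → A)) → ℝ := fun σ => (∏ g, prior η (σ g)) * groupMass B σ ^ k with hu
  have hu0 : ∀ σ, 0 ≤ u σ := by
    intro σ
    refine mul_nonneg (Finset.prod_nonneg fun g _ => prior_nonneg hη0.le (by linarith) _)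
      (pow_nonneg (Finset.sum_nonneg fun g _ => ?_) _)
    split_ifs
    exacts [hB0.le, zero_le_one]
  set Z : ℝ := ∑ σ, u σ with hZ
  have hφ : ∀ t, 1 / 2 ≤ mixFactor η B t := mixFactor_ge_half hη0.le hη hB0.le
  have hmix0 : ∀ z : Fin k → Γ × A × κ × A, 0 < mixture η B 0 z := by
    intro z
    rw [mixture_zero]
    exact Finset.prod_pos fun g _ => by linarith [hφ (count (fun s => (z s).1) g)]
  have hsum : ∀ e' : ℝ, ∑ z : Fin k → Γ × A × κ × A, mixture η B e' z = C * Z :=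
    fun e' => sum_mixture
  have hne : Nonempty (Fin k → Γ × A × κ × A) := inferInstance
  have hCZ : 0 < C * Z := by
    rw [← hsum 0]
    exact Finset.sum_pos (fun z _ => hmix0 z) Finset.univ_nonempty
  have hZpos : 0 < Z := pos_of_mul_pos_right hCZ hCpos.le
  have hsplit := Finset.sum_add_sum_compl bad u
  have hgood : 0.9 * Z ≤ ∑ σ ∈ badᶜ, u σ := by
    change ∑ σ ∈ bad, u σ ≤ 0.1 * Z at hbad
    linarith
  have h0 : 0.81 * Z ≤ ∑ σ, u σ * outputProb T phat
      (stdSimplex.map f (stateDist hB0 le_rfl zero_le_one σ)) Verdict.accept := by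
    have h1 : ∑ σ ∈ badᶜ, u σ * 0.9 ≤ ∑ σ, u σ * outputProb T phat
        (stdSimplex.map f (stateDist hB0 le_rfl zero_le_one σ)) Verdict.accept := by
      refine (Finset.sum_le_sum fun σ hσ => ?_).trans (Finset.sum_le_sum_of_subset_of_nonneg
        (Finset.subset_univ badᶜ) fun σ _ _ => mul_nonneg (hu0 σ) (outputProb_nonneg _ _ _ _))
      exact mul_le_mul_of_nonneg_left (hnull σ (Finset.mem_compl.1 hσ)) (hu0 σ)
    rw [← Finset.sum_mul] at h1
    linarith
  have h1 : ∑ σ, u σ * outputProb T phat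
      (stdSimplex.map f (stateDist hB0 he he1 σ)) Verdict.accept ≤ 0.15 * Z := by
    rw [← Finset.sum_add_sum_compl bad]
    have h2 : ∑ σ ∈ bad, u σ * outputProb T phat
        (stdSimplex.map f (stateDist hB0 he he1 σ)) Verdict.accept ≤ ∑ σ ∈ bad, u σ :=
      Finset.sum_le_sum fun σ _ => mul_le_of_le_one_right (hu0 σ) (outputProb_le_one _ _ _ _)
    have h3 : ∑ σ ∈ badᶜ, u σ * outputProb T phat
        (stdSimplex.map f (stateDist hB0 he he1 σ)) Verdict.accept ≤ ∑ σ ∈ badᶜ, u σ * 0.05 :=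
      Finset.sum_le_sum fun σ hσ =>
        mul_le_mul_of_nonneg_left (halt σ (Finset.mem_compl.1 hσ)) (hu0 σ)
    have h4 : ∑ σ ∈ badᶜ, u σ ≤ Z := Finset.sum_le_sum_of_subset_of_nonneg
      (Finset.subset_univ _) fun σ _ _ => hu0 σ
    rw [← Finset.sum_mul] at h3
    change ∑ σ ∈ bad, u σ ≤ 0.1 * Z at hbad
    linarith
  have hCS := sq_sum_sub_mul_le (fun z : Fin k → Γ × A × κ × A => mixture η B 0 z)
    (fun z => mixture η B e z) (fun z => (T phat (f ∘ z)).1 Verdict.accept) hmix0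
    (fun z => (T phat (f ∘ z)).2.1 _)
    (fun z => stdSimplex.le_one (T phat (f ∘ z)) Verdict.accept)
    (by rw [hsum, hsum])
  have hχ := sum_mixture_sq_div_le (Γ := Γ) (κ := κ) (A := A) (k := k) hη0 hη hB he he1
  rw [sum_mixture_mul hB0 le_rfl zero_le_one, sum_mixture_mul hB0 he he1, hsum, ← hC] at hCS
  rw [hsum] at hχ
  set P := C * Z with hP
  -- The null accepts with weight at least 0.9 · 0.9 = 0.81, the alternative at most 0.1 + 0.05 =
  -- 0.15; and 1 + 0.66² exceeds 1.4.
  have hdiff : 0.66 * P ≤ C * (∑ σ, u σ * outputProb T phat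
      (stdSimplex.map f (stateDist hB0 le_rfl zero_le_one σ)) Verdict.accept) -
      C * ∑ σ, u σ * outputProb T phat
      (stdSimplex.map f (stateDist hB0 he he1 σ)) Verdict.accept := by
    rw [← mul_sub, hP, mul_left_comm]
    exact mul_le_mul_of_nonneg_left (by linarith) hCpos.le
  have hsq : (0.66 * P) ^ 2 ≤ (X * P - P) * P := by
    refine (pow_le_pow_left₀ (by positivity) hdiff 2).trans (hCS.trans ?_)
    refine mul_le_mul_of_nonneg_right ?_ hCZ.le
    linarith
  have : (0.66 : ℝ) ^ 2 * (P * P) ≤ (X - 1) * (P * P) := by nlinarith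
  have := le_of_mul_le_mul_right this (by positivity)
  norm_num at this ⊢
  linarith

end HeavyNull

/-! ### The number of heavy row groups -/

section HeavyCount

variable {Γ A κ : Type*} [Fintype Γ]

/-- The number of heavy row groups. -/
def heavyCount (σ : Γ → Bool × (κ → A)) : ℕ := #{g | (σ g).1 = true}

theorem groupMass_eq (B : ℝ) (σ : Γ → Bool × (κ → A)) :
    groupMass B σ = Fintype.card Γ + (B - 1) * heavyCount σ := by
  have h : ∀ g, (if (σ g).1 then B else 1) = 1 + (B - 1) * if (σ g).1 = true then 1 else 0 := by
    intro g; split_ifs <;> ring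
  unfold groupMass heavyCount
  simp_rw [h, Finset.sum_add_distrib, ← Finset.mul_sum]
  simp

theorem heavyCount_add_card_light (σ : Γ → Bool × (κ → A)) :
    (heavyCount σ : ℝ) + #{g | ¬ (σ g).1 = true} = Fintype.card Γ := by
  have := Finset.card_filter_add_card_filter_not (s := (univ : Finset Γ))
    (fun g => (σ g).1 = true)
  unfold heavyCount
  rw [← Finset.card_univ]
  exact_mod_cast this

theorem card_le_groupMass {B : ℝ} (hB : 1 ≤ B) (σ : Γ → Bool × (κ → A)) :
    (Fintype.card Γ : ℝ) ≤ groupMass B σ := by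
  rw [groupMass_eq]
  have : 0 ≤ (B - 1) * heavyCount σ := mul_nonneg (by linarith) (Nat.cast_nonneg _)
  linarith

theorem groupMass_pos [Nonempty Γ] {B : ℝ} (hB : 0 < B) (σ : Γ → Bool × (κ → A)) : 0 < groupMass B σ :=
  Finset.sum_pos (fun g _ => by split_ifs; exacts [hB, one_pos]) Finset.univ_nonempty

/-- By `1 + x ≤ exp x` each heavy group multiplies the power by at most `exp (k B / |Γ|)`, and the
bound on `k * B` makes this at most `exp 1`. -/
theorem groupMass_pow_le [Nonempty Γ] {B : ℝ} (hB : 0 ≤ B) {k : ℕ}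
    (hk : k * B ≤ Fintype.card Γ) (σ : Γ → Bool × (κ → A)) :
    groupMass B σ ^ k ≤ (Fintype.card Γ : ℝ) ^ k * Real.exp (heavyCount σ) := by
  set G : ℝ := (Fintype.card Γ : ℝ)
  set N : ℝ := (heavyCount σ : ℝ) with hN
  have hG : 0 < G := by positivity
  have hN0 : 0 ≤ N := Nat.cast_nonneg _
  have h0 : 0 ≤ groupMass B σ :=
    Finset.sum_nonneg fun g _ => by split_ifs; exacts [hB, zero_le_one]
  have h1 : groupMass B σ ≤ G * Real.exp (B * N / G) := by
    have h2 := mul_le_mul_of_nonneg_left (Real.add_one_le_exp (B * N / G)) hG.le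
    have h3 : G * (B * N / G + 1) = B * N + G := by field_simp
    rw [groupMass_eq]
    linarith
  calc groupMass B σ ^ k ≤ (G * Real.exp (B * N / G)) ^ k := pow_le_pow_left₀ h0 h1 k
    _ = G ^ k * Real.exp (k * (B * N / G)) := by rw [mul_pow, ← Real.exp_nat_mul]
    _ ≤ _ := by
        refine mul_le_mul_of_nonneg_left (Real.exp_le_exp.2 ?_) (by positivity)
        have : k * (B * N / G) = (k * B) * N / G := by ring
        rw [this, div_le_iff₀ hG]
        nlinarith

variable [DecidableEq Γ] [Fintype A] [Fintype κ] [DecidableEq κ] [Nonempty A]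

theorem sum_prod_prior (η : ℝ) : ∑ σ : Γ → Bool × (κ → A), ∏ g, prior η (σ g) = 1 := by
  rw [sum_prod_eq_prod_sum fun _ τ => prior η τ]
  have := sum_prior_mul (A := A) (κ := κ) η (fun _ => 1)
  simp only [mul_one, add_sub_cancel] at this
  simp [this]

/-- The binomial moment generating function at 2: one unit of the exponent pays for the tilt by the
mass, the other for the Chernoff bound. -/
theorem sum_prod_prior_mul_exp_le {η : ℝ} (hη0 : 0 ≤ η) (hη1 : η ≤ 1) :
    ∑ σ : Γ → Bool × (κ → A), (∏ g, prior η (σ g)) * Real.exp (2 * heavyCount σ) ≤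
      Real.exp (η * Fintype.card Γ * (Real.exp 2 - 1)) := by
  have h : ∀ σ : Γ → Bool × (κ → A), (∏ g, prior η (σ g)) * Real.exp (2 * heavyCount σ) =
      ∏ g, (prior η (σ g) * if (σ g).1 = true then Real.exp 2 else 1) := by
    intro σ
    rw [Finset.prod_mul_distrib]
    congr 1
    rw [Finset.prod_ite, Finset.prod_const, Finset.prod_const_one, mul_one, ← Real.exp_nat_mul,
      mul_comm]
    rfl
  simp_rw [h]
  rw [sum_prod_eq_prod_sum fun _ τ => prior η τ * if τ.1 = true then Real.exp 2 else 1]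
  have h1 := sum_prior_mul (A := A) (κ := κ) η (fun b => if b = true then Real.exp 2 else 1)
  simp only at h1
  simp_rw [h1]
  rw [Finset.prod_const, Finset.card_univ]
  simp only [if_true, Bool.false_eq_true, if_false]
  calc _ ≤ (Real.exp (η * (Real.exp 2 - 1))) ^ Fintype.card Γ := by
        refine pow_le_pow_left₀ (by nlinarith [Real.exp_pos 2]) ?_ _
        linarith [Real.add_one_le_exp (η * (Real.exp 2 - 1))]
    _ = _ := by rw [← Real.exp_nat_mul]; congr 1; ring

/-- Under the prior tilted by the total mass, it is unlikely that far more row groups than expected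
are heavy. -/
theorem sum_bad_le [Nonempty Γ] {η B : ℝ} (hη0 : 0 ≤ η) (hη1 : η ≤ 1) (hB : 1 ≤ B) {k : ℕ}
    (hk : k * B ≤ Fintype.card Γ) (hh : 1 ≤ η * Fintype.card Γ)
    (bad : Finset (Γ → Bool × (κ → A)))
    (hbad : ∀ σ ∈ bad, 10 * (η * Fintype.card Γ) ≤ heavyCount σ) :
    ∑ σ ∈ bad, (∏ g, prior η (σ g)) * groupMass B σ ^ k ≤
      0.1 * ∑ σ : Γ → Bool × (κ → A), (∏ g, prior η (σ g)) * groupMass B σ ^ k := by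
  set G : ℝ := (Fintype.card Γ : ℝ) with hG
  set h : ℝ := η * G with hh'
  have hGpos : 0 < G := by positivity
  have hp : ∀ σ : Γ → Bool × (κ → A), 0 ≤ ∏ g, prior η (σ g) := fun σ =>
    Finset.prod_nonneg fun g _ => prior_nonneg hη0 hη1 _
  have hlow : G ^ k ≤ ∑ σ : Γ → Bool × (κ → A), (∏ g, prior η (σ g)) * groupMass B σ ^ k := by
    calc G ^ k = ∑ σ : Γ → Bool × (κ → A), (∏ g, prior η (σ g)) * G ^ k := by
          rw [← Finset.sum_mul, sum_prod_prior, one_mul]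
      _ ≤ _ := Finset.sum_le_sum fun σ _ => mul_le_mul_of_nonneg_left
          (pow_le_pow_left₀ hGpos.le (card_le_groupMass hB σ) k) (hp σ)
  have hup : ∑ σ ∈ bad, (∏ g, prior η (σ g)) * groupMass B σ ^ k ≤
      G ^ k * Real.exp (-(10 * h)) * Real.exp (h * (Real.exp 2 - 1)) := by
    calc _ ≤ ∑ σ ∈ bad, G ^ k * Real.exp (-(10 * h)) *
          ((∏ g, prior η (σ g)) * Real.exp (2 * heavyCount σ)) := by
          refine Finset.sum_le_sum fun σ hσ => ?_
          have h1 := groupMass_pow_le (by linarith) hk σ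
          have h2 : Real.exp (heavyCount σ) ≤
              Real.exp (-(10 * h)) * Real.exp (2 * heavyCount σ) := by
            rw [← Real.exp_add]
            exact Real.exp_le_exp.2 (by linarith [hbad σ hσ])
          have h3 := h1.trans (mul_le_mul_of_nonneg_left h2 (by positivity))
          refine (mul_le_mul_of_nonneg_left h3 (hp σ)).trans_eq ?_
          ring
      _ ≤ ∑ σ, G ^ k * Real.exp (-(10 * h)) *
          ((∏ g, prior η (σ g)) * Real.exp (2 * heavyCount σ)) :=
          Finset.sum_le_sum_of_subset_of_nonneg (Finset.subset_univ _) fun σ _ _ =>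
            mul_nonneg (by positivity) (mul_nonneg (hp σ) (Real.exp_pos _).le)
      _ ≤ _ := by
          rw [← Finset.mul_sum]
          exact mul_le_mul_of_nonneg_left (sum_prod_prior_mul_exp_le hη0 hη1) (by positivity)
  -- As `exp 2 ≤ 8` and `h ≥ 1`, the exponent is at most `-10h + 7h ≤ -3`.
  have hexp : Real.exp (-(10 * h)) * Real.exp (h * (Real.exp 2 - 1)) ≤ 0.1 := by
    have he2 : Real.exp 2 ≤ 8 := by
      have h1 : Real.exp 2 = Real.exp 1 ^ 2 := by rw [← Real.exp_nat_mul]; norm_num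
      have h2 := Real.exp_one_lt_d9
      have h3 := Real.exp_pos 1
      rw [h1]
      nlinarith
    have he3 : (10 : ℝ) ≤ Real.exp 3 := by
      have h1 : Real.exp 3 = Real.exp 1 ^ 3 := by rw [← Real.exp_nat_mul]; norm_num
      have h2 := Real.exp_one_gt_d9
      rw [h1]
      calc (10 : ℝ) ≤ 2.7 ^ 3 := by norm_num
        _ ≤ _ := pow_le_pow_left₀ (by norm_num) (by linarith) 3
    rw [← Real.exp_add]
    calc _ ≤ Real.exp (-3) := Real.exp_le_exp.2 (by nlinarith)
      _ = (Real.exp 3)⁻¹ := Real.exp_neg 3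
      _ ≤ (10 : ℝ)⁻¹ := inv_anti₀ (by norm_num) he3
      _ = 0.1 := by norm_num
  have hGk : 0 < G ^ k := by positivity
  calc _ ≤ _ := hup
    _ ≤ G ^ k * 0.1 := by
        rw [mul_assoc]; exact mul_le_mul_of_nonneg_left hexp hGk.le
    _ ≤ _ := by linarith

end HeavyCount

/-! ### Null states are close products, perturbed states are far -/

section StateDist

variable {Γ A κ : Type*} [Fintype Γ] [Fintype A] [Fintype κ] [AddCommGroup A] [DecidableEq A]
  [Nonempty Γ] [Nonempty κ] {n m : ℕ}

theorem stateDist_apply {B e : ℝ} (hB : 0 < B) (he : 0 ≤ e) (he1 : e ≤ 1)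
    (σ : Γ → Bool × (κ → A)) (ω : Γ × A × κ × A) :
    (stateDist hB he he1 σ).1 ω = cellWeight B e (σ ω.1) ω.2 /
      ((Fintype.card A : ℝ) ^ 2 * Fintype.card κ * groupMass B σ) := by
  rw [← sum_cellWeight_eq_groupMass B e σ]
  rfl

theorem isProductDist_stateDist_zero {B : ℝ} (hB : 0 < B) (ρ : Γ × A → Fin n) (γ : κ × A → Fin m)
    (σ : Γ → Bool × (κ → A)) :
    IsProductDist (stdSimplex.map (cellMap ρ γ) (stateDist hB le_rfl zero_le_one σ)) := by
  have hA : Nonempty A := ⟨0⟩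
  have hW := groupMass_pos hB σ
  have hL : (0 : ℝ) < Fintype.card A := by positivity
  have hM : (0 : ℝ) < Fintype.card κ := by positivity
  have hsum : ∑ x : Γ × A, (if (σ x.1).1 then B else 1) = groupMass B σ * Fintype.card A := by
    rw [Fintype.sum_prod_type, groupMass, Finset.sum_mul]
    refine Finset.sum_congr rfl fun g _ => ?_
    change ∑ _y : A, (if (σ g).1 = true then B else 1) = _
    rw [Finset.sum_const, Finset.card_univ, nsmul_eq_mul, mul_comm]
  refine isProductDist_map_cellMap
    (normalize (fun x : Γ × A => if (σ x.1).1 then B else 1)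
      (fun x => by split_ifs; exacts [hB.le, zero_le_one]) (by rw [hsum]; positivity))
    (uniform (κ × A)) _ fun ω => ?_
  rw [stateDist_apply, cellWeight_zero]
  simp only [normalize, hsum, uniform, Fintype.card_prod]
  push_cast
  field_simp

/-- Normalisation can only push light cells below the uniform value, so all the excess sits in heavy
groups and is at most their mass. -/
theorem tvDist_stateDist_zero_le {B : ℝ} (hB : 1 ≤ B) (σ : Γ → Bool × (κ → A))
    [Nonempty (Γ × A × κ × A)] :
    tvDist (stateDist (zero_lt_one.trans_le hB) le_rfl zero_le_one σ) (uniform _) ≤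
      B * heavyCount σ / Fintype.card Γ := by
  have hA : Nonempty A := ⟨0⟩
  have hB0 : 0 < B := by linarith
  have hW := groupMass_pos hB0 σ
  have hWG := card_le_groupMass hB σ
  have hL : (0 : ℝ) < Fintype.card A := by positivity
  have hM : (0 : ℝ) < Fintype.card κ := by positivity
  have hG : (0 : ℝ) < Fintype.card Γ := by positivity
  set C : ℝ := (Fintype.card A : ℝ) ^ 2 * Fintype.card κ with hC
  have hCpos : 0 < C := by positivity
  have hunif : ∀ ω, (uniform (Γ × A × κ × A)).1 ω = 1 / (C * Fintype.card Γ) := by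
    intro ω
    simp only [uniform, Fintype.card_prod, hC]
    push_cast
    ring
  rw [tvDist_eq_sum_sub_min, Fintype.sum_prod_type]
  have hcell : ∀ (g : Γ) (c : A × κ × A),
      (stateDist hB0 le_rfl zero_le_one σ).1 (g, c) -
        min ((stateDist hB0 le_rfl zero_le_one σ).1 (g, c)) ((uniform (Γ × A × κ × A)).1 (g, c)) ≤
      if (σ g).1 = true then B / (C * Fintype.card Γ) else 0 := by
    intro g c
    rw [stateDist_apply, cellWeight_zero, hunif, ← hC]
    split_ifs
    · have h1 : B / (C * groupMass B σ) ≤ B / (C * Fintype.card Γ) :=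
        div_le_div_of_nonneg_left hB0.le (by positivity) (mul_le_mul_of_nonneg_left hWG hCpos.le)
      have h2 : 0 ≤ min (B / (C * groupMass B σ)) (1 / (C * Fintype.card Γ)) :=
        le_min (by positivity) (by positivity)
      linarith
    · have h1 : 1 / (C * groupMass B σ) ≤ 1 / (C * Fintype.card Γ) :=
        div_le_div_of_nonneg_left zero_le_one (by positivity)
          (mul_le_mul_of_nonneg_left hWG hCpos.le)
      rw [min_eq_left h1, sub_self]
  refine (Finset.sum_le_sum fun g _ => Finset.sum_le_sum fun c _ => hcell g c).trans_eq ?_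
  simp only [Finset.sum_const, Finset.card_univ, Fintype.card_prod, nsmul_eq_mul, ← Finset.mul_sum]
  rw [← Finset.sum_filter, Finset.sum_const, nsmul_eq_mul]
  change _ * ((heavyCount σ : ℝ) * _) = _
  push_cast
  rw [hC]
  field_simp

theorem stateDist_light_mass {A : Type*} [Fintype A] [Nonempty A] {B : ℝ} (hB : 1 ≤ B) (σ : Γ → Bool × (κ → A)) :
    1 - B * heavyCount σ / Fintype.card Γ ≤
      1 / ((Fintype.card A : ℝ) ^ 2 * Fintype.card κ * groupMass B σ) *
        (Fintype.card A : ℝ) ^ 2 * (#{g | ¬ (σ g).1 = true} * Fintype.card κ) := by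
  have hB0 : 0 < B := by linarith
  have hW := groupMass_pos hB0 σ
  have hWG := card_le_groupMass hB σ
  have hlight := heavyCount_add_card_light σ
  have hmass := groupMass_eq B σ
  have hL : (0 : ℝ) < Fintype.card A := by positivity
  have hM : (0 : ℝ) < Fintype.card κ := by positivity
  have hG : (0 : ℝ) < Fintype.card Γ := by positivity
  have h1 : 1 / ((Fintype.card A : ℝ) ^ 2 * Fintype.card κ * groupMass B σ) *
        (Fintype.card A : ℝ) ^ 2 * (#{g | ¬ (σ g).1 = true} * Fintype.card κ) =
      #{g | ¬ (σ g).1 = true} / groupMass B σ := by field_simp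
  rw [h1]
  have h2 : (#{g | ¬ (σ g).1 = true} : ℝ) = groupMass B σ - B * heavyCount σ := by
    rw [hmass]; linarith
  rw [h2, sub_div, div_self hW.ne']
  have : B * heavyCount σ / groupMass B σ ≤ B * heavyCount σ / Fintype.card Γ :=
    div_le_div_of_nonneg_left (by positivity) hG hWG
  linarith

/-- The light groups keep mass at least 0.9. Tilt `5ε` gives at least 0.9 · 5ε/4 > ε; full tilt
gives at least 3/4 · 0.9 − 1/4 > 1/3. Side four provides this slack: the bound used for side two is
exactly 1/3 at full mass, leaving no room for heavy groups. -/
theorem isFarFromProduct_stateDist [Nontrivial A] (hcard : Fintype.card A = 4) {B ε e : ℝ}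
    (hB : 1 ≤ B) (hB0 : 0 < B) (hε : 0 < ε) (hε3 : ε < 1 / 3) (he0 : 0 ≤ e) (he1 : e ≤ 1)
    (he : e = min 1 (5 * ε))
    {ρ : Γ × A → Fin n} {γ : κ × A → Fin m} (hρ : Function.Injective ρ)
    (hγ : Function.Injective γ) (σ : Γ → Bool × (κ → A))
    (hσ : B * heavyCount σ / Fintype.card Γ ≤ 1 / 10) :
    IsFarFromProduct ε (stdSimplex.map (cellMap ρ γ)
      (stateDist hB0 he0 he1 σ)) := by
  intro q hq
  have hW := groupMass_pos hB0 σ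
  have hmass := stateDist_light_mass hB σ
  have hcell : ∀ g ∈ (univ.filter fun g => ¬ (σ g).1 = true), ∀ i J j,
      (stdSimplex.map (cellMap ρ γ) (stateDist hB0 he0 he1 σ)).1
        (cellMap ρ γ (g, i, J, j)) =
      1 / ((Fintype.card A : ℝ) ^ 2 * Fintype.card κ * groupMass B σ) *
        (1 + e * bump ((σ g).2 J) i j) := by
    intro g hg i J j
    have hg' := (Finset.mem_filter.1 hg).2
    rw [map_apply_of_injective (cellMap_injective hρ hγ), stateDist_apply]
    simp only [cellWeight, hg', Bool.false_eq_true, if_false]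
    ring
  set c : ℝ := 1 / ((Fintype.card A : ℝ) ^ 2 * Fintype.card κ * groupMass B σ) with hc
  have hc0 : 0 ≤ c := by positivity
  set S : Finset Γ := univ.filter fun g => ¬ (σ g).1 = true
  rcases lt_or_ge ε (1 / 5) with h5 | h5
  · have h := le_tvDist_of_perturbed hρ hγ S (fun g J => (σ g).2 J) hcell hq
    set ℓ : ℝ := c * (Fintype.card A : ℝ) ^ 2 * (#S * Fintype.card κ)
    have hℓ : 0.9 ≤ ℓ := by linarith
    rw [min_eq_right (by linarith)] at he
    have : ε < e / 4 * ℓ := by rw [he]; nlinarith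
    linarith
  · obtain rfl : e = 1 := by rw [he, min_eq_left (by linarith)]
    have h := le_tvDist_of_fully_perturbed hρ hγ S hc0 (by norm_num : (0 : ℝ) ≤ 1 / 4)
      (fun C hC r a b ha hb => sum_min_mul_le hC r a b ha hb) (fun g J => (σ g).2 J) hcell hq
    have hℓ : c * (Fintype.card A : ℝ) * (#S * Fintype.card κ) =
        c * (Fintype.card A : ℝ) ^ 2 * (#S * Fintype.card κ) / 4 := by
      rw [hcard]; push_cast; ring
    rw [hℓ] at h
    set ℓ : ℝ := c * (Fintype.card A : ℝ) ^ 2 * (#S * Fintype.card κ)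
    have hℓ : 0.9 ≤ ℓ := by linarith
    linarith

end StateDist

/-! ### Choice of parameters and the two regimes -/

/-- The lower bound in the regime where heavy rows mask collisions, in terms of the number `k₀`
of samples that the heavy rows are tuned to. -/
theorem le_exp_of_masking {n m k : ℕ} {α ε k₀ : ℝ} {T : Tester n m k} (hn : 4 ≤ n) (hm : 4 ≤ m)
    (hα : 0 < α) (hα1 : α ≤ 1) (hε : 0 < ε) (hε3 : ε < 1 / 3)
    (hT : IsAugmentedIndependenceTester α ε 0.1 T) (hk : k ≤ k₀) (hk₀ : 4 * k₀ ≤ (n / 4 : ℕ))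
    (hheavy : 100 ≤ α * k₀) :
    1.4 ≤ Real.exp (8000000 * ε ^ 4 * k₀ ^ 3 / (α * (m / 4 : ℕ) * ((n / 4 : ℕ) : ℝ) ^ 2)) := by
  classical
  obtain ⟨ρ, hρ⟩ := exists_injective_fin_div (n := n) (L := 4)
  obtain ⟨γ, hγ⟩ := exists_injective_fin_div (n := m) (L := 4)
  have hΓ : Nonempty (Fin (n / 4)) := ⟨⟨0, by omega⟩⟩
  have hκ : Nonempty (Fin (m / 4)) := ⟨⟨0, by omega⟩⟩
  have hGpos : (0 : ℝ) < (n / 4 : ℕ) := by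
    have : 0 < n / 4 := by omega
    exact_mod_cast this
  have hMpos : (0 : ℝ) < (m / 4 : ℕ) := by
    have : 0 < m / 4 := by omega
    exact_mod_cast this
  have hk₀pos : 0 < k₀ := by nlinarith
  set G : ℝ := ((n / 4 : ℕ) : ℝ) with hG
  set M : ℝ := ((m / 4 : ℕ) : ℝ) with hM
  have hcardΓ : (Fintype.card (Fin (n / 4)) : ℝ) = G := by rw [Fintype.card_fin]
  have hcardκ : (Fintype.card (Fin (m / 4)) : ℝ) = M := by rw [Fintype.card_fin]
  have hnt : Nontrivial (ZMod 4) := ⟨0, 1, by decide⟩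
  have hcardA : Fintype.card (ZMod 4) = 4 := ZMod.card 4
  -- A heavy group then expects about one of `k₀` samples.
  set B : ℝ := G / k₀ with hB
  have hB4 : 4 ≤ B := by rw [hB, le_div_iff₀ hk₀pos]; exact hk₀
  have hB0 : 0 < B := by linarith
  have hB1 : 1 ≤ B := by linarith
  -- This makes `η B = α / 100`, so even ten times the expected number of heavy groups carries mass
  -- at most `α / 10`. The expected number `α k₀ / 100` is at least 1 by `hheavy`.
  set η : ℝ := α * k₀ / (100 * G) with hη
  have hη0 : 0 < η := by positivity
  have hηG : η * G = α * k₀ / 100 := by rw [hη]; field_simp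
  have hηB : η * B = α / 100 := by rw [hη, hB]; field_simp
  have hηhalf : η ≤ 1 / 2 := by nlinarith
  set e : ℝ := min 1 (5 * ε) with he
  have he0 : 0 ≤ e := le_min zero_le_one (by linarith)
  have he1 : e ≤ 1 := min_le_left _ _
  have he5 : e ≤ 5 * ε := min_le_right _ _
  set bad : Finset (Fin (n / 4) → Bool × (Fin (m / 4) → ZMod 4)) :=
    univ.filter fun σ => 10 * (η * G) ≤ heavyCount σ with hbad
  have hgood : ∀ σ, σ ∉ bad → B * heavyCount σ / Fintype.card (Fin (n / 4)) ≤ α / 10 := by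
    intro σ hσ
    have h1 : (heavyCount σ : ℝ) < 10 * (η * G) := by simpa [hbad] using hσ
    rw [hcardΓ, div_le_iff₀ hGpos]
    nlinarith
  have key := le_exp_of_heavy_null (k := k) hη0 hηhalf hB0 (by rw [hcardA]; exact_mod_cast hB4)
    he0 he1 T (stdSimplex.map (cellMap ρ γ) (uniform _)) (cellMap ρ γ) bad
    (fun σ hσ => le_outputProb_accept hT (isProductDist_stateDist_zero hB0 ρ γ σ)
      ((tvDist_map_le _ _ _).trans ((tvDist_stateDist_zero_le hB1 σ).trans
        ((hgood σ hσ).trans (by linarith)))))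
    (fun σ hσ => by
      have := hT.accept_le (stdSimplex.map (cellMap ρ γ) (uniform _)) _
        (isFarFromProduct_stateDist hcardA hB1 hB0 hε hε3 he0 he1 he hρ hγ σ
          ((hgood σ hσ).trans (by linarith)))
      linarith)
    (sum_bad_le hη0.le (by linarith) hB1 (by
        rw [hcardΓ, hB]
        calc (k : ℝ) * (G / k₀) ≤ k₀ * (G / k₀) :=
              mul_le_mul_of_nonneg_right hk (by positivity)
          _ = G := by field_simp)
      (by rw [hcardΓ, hηG]; linarith) bad
      (fun σ hσ => by rw [hcardΓ]; simpa [hbad] using hσ))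
  refine key.trans (Real.exp_le_exp.2 ?_)
  rw [hcardΓ, hcardκ, hcardA]
  have hk0 : (0 : ℝ) ≤ k := Nat.cast_nonneg k
  have hB2 : B ^ 2 * η * G = G ^ 2 * α / (100 * k₀) := by
    calc B ^ 2 * η * G = B * G * (η * B) := by ring
      _ = _ := by rw [hηB, hB]; field_simp
  have hlhs : 2 * ((((4 : ℕ) : ℝ) / B) ^ 2 * (e ^ 4 * ((4 : ℕ) : ℝ) / M) / η) * k ^ 2 / G =
      12800 * e ^ 4 * k ^ 2 * k₀ / (α * M * G ^ 2) := by
    have : 2 * ((((4 : ℕ) : ℝ) / B) ^ 2 * (e ^ 4 * ((4 : ℕ) : ℝ) / M) / η) * k ^ 2 / G =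
        128 * e ^ 4 * k ^ 2 / (M * (B ^ 2 * η * G)) := by
      push_cast
      field_simp
      ring
    rw [this, hB2]
    field_simp
    ring
  rw [hlhs]
  refine div_le_div_of_nonneg_right ?_ (by positivity)
  have h1 : e ^ 4 ≤ 625 * ε ^ 4 := by
    calc e ^ 4 ≤ (5 * ε) ^ 4 := pow_le_pow_left₀ he0 he5 4
      _ = _ := by ring
  have h2 : (k : ℝ) ^ 2 ≤ k₀ ^ 2 := pow_le_pow_left₀ hk0 hk 2
  have h3 : e ^ 4 * (k : ℝ) ^ 2 ≤ 625 * ε ^ 4 * k₀ ^ 2 :=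
    mul_le_mul h1 h2 (by positivity) (by positivity)
  calc 12800 * e ^ 4 * (k : ℝ) ^ 2 * k₀ = 12800 * (e ^ 4 * (k : ℝ) ^ 2) * k₀ := by ring
    _ ≤ 12800 * (625 * ε ^ 4 * k₀ ^ 2) * k₀ := by gcongr
    _ = _ := by ring

/-- The regime yields `b ≤ n` and `α b ≥ 10⁶`, which makes `k₀ = b / 10000` admissible in
`le_exp_of_masking`. If `k` were below `k₀`, the exponent there would be at most 1/4, while `exp
(1/4) < 1.4`. -/
theorem le_of_masking_regime {n m k : ℕ} {α ε b : ℝ} {T : Tester n m k} (hm : 2 ≤ m)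
    (hlog : Real.log n ≤ m) (hα : 0 ≤ α) (hα1 : α ≤ 1) (hε : 0 < ε)
    (hε3 : ε < 1 / 3) (hT : IsAugmentedIndependenceTester α ε 0.1 T) (hb : 0 ≤ b)
    (hb3 : b ^ 3 * ε ^ 4 = (n : ℝ) ^ 2 * m * α)
    (hreg : 1000000 * (m : ℝ) < n * α ^ 2 * ε ^ 4) : b / 10000 ≤ k := by
  by_contra! hcon
  have hmR : (2 : ℝ) ≤ m := by exact_mod_cast hm
  have hαpos : 0 < α := by
    rcases hα.lt_or_eq with h | h
    · exact h
    · rw [← h] at hreg; norm_num at hreg; linarith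
  have hn0 : (0 : ℝ) ≤ n := Nat.cast_nonneg n
  have hε4 : 0 < ε ^ 4 := by positivity
  have hε81 : ε ^ 4 ≤ 1 / 81 := by
    calc ε ^ 4 ≤ (1 / 3 : ℝ) ^ 4 := pow_le_pow_left₀ hε.le hε3.le 4
      _ = _ := by norm_num
  have hα2 : α ^ 2 ≤ 1 := pow_le_one₀ hα hα1
  have hnα : (n : ℝ) * α ^ 2 ≤ n := by nlinarith
  have hnε : 1000000 * (m : ℝ) < n * ε ^ 4 :=
    hreg.trans_le (mul_le_mul_of_nonneg_right hnα hε4.le)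
  have hnbig : (1000000 : ℝ) ≤ n := by nlinarith
  have hn : 1000000 ≤ n := by exact_mod_cast hnbig
  -- The hypothesis `log n ≤ m` enters only here, to make room for column blocks of width four.
  have hm4 : 4 ≤ m := by
    have h4 : Real.exp 4 ≤ n := by
      have h1 : Real.exp 4 = Real.exp 1 ^ 4 := by rw [← Real.exp_nat_mul]; norm_num
      have h2 := Real.exp_one_lt_d9
      calc Real.exp 4 = Real.exp 1 ^ 4 := h1
        _ ≤ (3 : ℝ) ^ 4 := pow_le_pow_left₀ (Real.exp_pos 1).le (by linarith) 4
        _ ≤ n := by linarith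
    have h5 : (4 : ℝ) ≤ Real.log n := (Real.le_log_iff_exp_le (by linarith)).2 h4
    exact_mod_cast h5.trans hlog
  have hG : (n : ℝ) / 5 ≤ (n / 4 : ℕ) := by
    have h : n ≤ 5 * (n / 4) := by omega
    have : (n : ℝ) ≤ 5 * (n / 4 : ℕ) := by exact_mod_cast h
    linarith
  have hM : (m : ℝ) / 7 ≤ (m / 4 : ℕ) := by
    have h : m ≤ 7 * (m / 4) := by omega
    have : (m : ℝ) ≤ 7 * (m / 4 : ℕ) := by exact_mod_cast h
    linarith
  have hbn : b ≤ n := by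
    have h1 : b ^ 3 * ε ^ 4 ≤ (n : ℝ) ^ 3 * ε ^ 4 := by
      rw [hb3]
      have h2 : (m : ℝ) * α ≤ n * ε ^ 4 := by nlinarith
      calc (n : ℝ) ^ 2 * m * α = n ^ 2 * (m * α) := by ring
        _ ≤ n ^ 2 * (n * ε ^ 4) := by gcongr
        _ = _ := by ring
    exact le_of_pow_le_pow_left₀ (by norm_num) hn0 (le_of_mul_le_mul_right h1 hε4)
  have hαb : 1000000 ≤ α * b := by
    have h1 : (1000000 : ℝ) ^ 3 * (ε ^ 4) ^ 3 ≤ (α * b) ^ 3 * (ε ^ 4) ^ 3 := by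
      have h2 : (α * b) ^ 3 * (ε ^ 4) ^ 3 = (n * α ^ 2 * ε ^ 4) ^ 2 * m := by
        calc (α * b) ^ 3 * (ε ^ 4) ^ 3 = α ^ 3 * (b ^ 3 * ε ^ 4) * (ε ^ 4) ^ 2 := by ring
          _ = _ := by rw [hb3]; ring
      rw [h2]
      have h3 : (1000000 * (m : ℝ)) ^ 2 ≤ (n * α ^ 2 * ε ^ 4) ^ 2 :=
        pow_le_pow_left₀ (by positivity) hreg.le 2
      have h4 : (ε ^ 4) ^ 3 ≤ (1 / 81 : ℝ) ^ 3 := pow_le_pow_left₀ hε4.le hε81 3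
      have h5 : (8 : ℝ) ≤ (m : ℝ) ^ 3 := by
        calc (8 : ℝ) = 2 ^ 3 := by norm_num
          _ ≤ _ := pow_le_pow_left₀ (by norm_num) hmR 3
      calc (1000000 : ℝ) ^ 3 * (ε ^ 4) ^ 3 ≤ 1000000 ^ 3 * (1 / 81) ^ 3 := by gcongr
        _ ≤ 1000000 ^ 2 * 8 := by norm_num
        _ ≤ 1000000 ^ 2 * (m : ℝ) ^ 3 := by gcongr
        _ = (1000000 * (m : ℝ)) ^ 2 * m := by ring
        _ ≤ _ := by gcongr
    exact le_of_pow_le_pow_left₀ (by norm_num) (by positivity)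
      (le_of_mul_le_mul_right h1 (by positivity))
  have key := le_exp_of_masking (k₀ := b / 10000) (by omega) hm4 hαpos hα1 hε hε3 hT hcon.le
    (by linarith) (by linarith)
  have hsmall : 8000000 * ε ^ 4 * (b / 10000) ^ 3 /
      (α * (m / 4 : ℕ) * ((n / 4 : ℕ) : ℝ) ^ 2) ≤ 1 / 4 := by
    have hden : α * (m / 7) * ((n : ℝ) / 5) ^ 2 ≤ α * (m / 4 : ℕ) * ((n / 4 : ℕ) : ℝ) ^ 2 := by
      gcongr
    have hpos : 0 < α * (m / 7) * ((n : ℝ) / 5) ^ 2 := by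
      have : (0 : ℝ) < n := by linarith
      positivity
    rw [div_le_iff₀ (hpos.trans_le hden)]
    have h1 : 8000000 * ε ^ 4 * (b / 10000) ^ 3 = 8000000 / 10000 ^ 3 * (b ^ 3 * ε ^ 4) := by ring
    rw [h1, hb3]
    nlinarith
  have hquarter : Real.exp (1 / 4) < 1.4 := by
    have h1 : Real.exp (1 / 4) ^ 4 = Real.exp 1 := by rw [← Real.exp_nat_mul]; norm_num
    have h2 := Real.exp_one_lt_d9
    apply lt_of_pow_lt_pow_left₀ 4 (by norm_num)
    rw [h1]
    norm_num at h2 ⊢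
    linarith
  linarith [Real.exp_le_exp.2 hsmall]

/-- Here `b⁶ε¹² = n³m² · (nα²ε⁴)`, at most `10⁶(nm)³` in this regime; the constant 10 is the sixth
root. -/
theorem le_of_direct_regime {n m α ε b : ℝ} (hn : 0 ≤ n) (hm : 0 ≤ m)
    (hε : 0 < ε) (hb3 : b ^ 3 * ε ^ 4 = n ^ 2 * m * α)
    (hreg : n * α ^ 2 * ε ^ 4 ≤ 1000000 * m) : b ≤ 10 * (√(n * m) / ε ^ 2) := by
  have hA : 0 ≤ √(n * m) := Real.sqrt_nonneg _
  have h1 : b ^ 6 * ε ^ 12 ≤ (10 * (√(n * m) / ε ^ 2)) ^ 6 * ε ^ 12 := by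
    have h2 : b ^ 6 * ε ^ 12 = n ^ 3 * m ^ 2 * (n * α ^ 2 * ε ^ 4) := by
      calc b ^ 6 * ε ^ 12 = (b ^ 3 * ε ^ 4) ^ 2 * ε ^ 4 := by ring
        _ = _ := by rw [hb3]; ring
    have h3 : (10 * (√(n * m) / ε ^ 2)) ^ 6 * ε ^ 12 = 1000000 * ((√(n * m)) ^ 2) ^ 3 := by
      field_simp
      ring
    rw [h2, h3, Real.sq_sqrt (by positivity)]
    calc n ^ 3 * m ^ 2 * (n * α ^ 2 * ε ^ 4) ≤ n ^ 3 * m ^ 2 * (1000000 * m) := by gcongr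
      _ = _ := by ring
  exact le_of_pow_le_pow_left₀ (by norm_num) (by positivity)
    (le_of_mul_le_mul_right h1 (by positivity))

end AugIndep

theorem theorem5 :
    ∃ c : ℝ, 0 < c ∧
      ∀ (n m k : ℕ) (α ε : ℝ) (T : AugIndep.Tester n m k),
        2 ≤ m → m ≤ n → Real.log (n : ℝ) ≤ (m : ℝ) →
        0 ≤ α → α ≤ 1 → 0 < ε → ε < 1 / 3 →
        AugIndep.IsAugmentedIndependenceTester α ε (0.1 : ℝ) T →
        c * max (Real.sqrt ((n : ℝ) * (m : ℝ)) / ε ^ 2)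
            ((n : ℝ) ^ (2 / 3 : ℝ) * (m : ℝ) ^ (1 / 3 : ℝ) * α ^ (1 / 3 : ℝ) / ε ^ (4 / 3 : ℝ))
          ≤ (k : ℝ) := by
  -- The masking regime dictates the constant; the direct one needs only 75 and 10 · 75.
  refine ⟨1 / 10000, by norm_num, ?_⟩
  intro n m k α ε T hm hmn hlog hα hα1 hε hε3 hT
  have h1 := AugIndep.sqrt_mul_div_sq_le (hm.trans hmn) hm hα hε hε3 hT
  have hn0 : (0 : ℝ) ≤ n := Nat.cast_nonneg n
  have hm0 : (0 : ℝ) ≤ m := Nat.cast_nonneg m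
  have hk0 : (0 : ℝ) ≤ k := Nat.cast_nonneg k
  set b : ℝ := (n : ℝ) ^ (2 / 3 : ℝ) * (m : ℝ) ^ (1 / 3 : ℝ) * α ^ (1 / 3 : ℝ) / ε ^ (4 / 3 : ℝ)
    with hb
  have hb0 : 0 ≤ b := by positivity
  have hrpow : ∀ x : ℝ, 0 ≤ x → ∀ y : ℝ, (x ^ (y / 3)) ^ 3 = x ^ y := by
    intro x hx y
    rw [← Real.rpow_natCast, ← Real.rpow_mul hx]
    norm_num
  have hb3 : b ^ 3 * ε ^ 4 = (n : ℝ) ^ 2 * m * α := by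
    rw [hb, div_pow, mul_pow, mul_pow, hrpow _ hn0, hrpow _ hm0, hrpow _ hα, hrpow _ hε.le,
      Real.rpow_one, Real.rpow_one]
    have e1 : (n : ℝ) ^ (2 : ℝ) = (n : ℝ) ^ 2 := by exact_mod_cast Real.rpow_natCast (n : ℝ) 2
    have e2 : ε ^ (4 : ℝ) = ε ^ 4 := by exact_mod_cast Real.rpow_natCast ε 4
    rw [e1, e2]
    field_simp
  have h2 : b ≤ 10000 * k := by
    rcases lt_or_ge (1000000 * (m : ℝ)) (n * α ^ 2 * ε ^ 4) with hreg | hreg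
    · linarith [AugIndep.le_of_masking_regime hm hlog hα hα1 hε hε3 hT hb0 hb3 hreg]
    · linarith [AugIndep.le_of_direct_regime hn0 hm0 hε hb3 hreg]
  have h3 : max (Real.sqrt ((n : ℝ) * (m : ℝ)) / ε ^ 2) b ≤ 10000 * k :=
    max_le (by linarith) h2
  linarith
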